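/- **Setting.** Let $L\ge 0$ and multiplicities $m_{-1},m_0,\dots,m_L\ge 0$ be given, and for each index $\alpha_s\in\{1,\dots,m_s\}$, $-1\le s\le L$, a number $\varepsilon_{\alpha_s}\in\mathbb Z/2$. The fields $\Phi^\alpha$ are the original fields $\varphi^i=\Phi^{\alpha_{-1}}$ and the stage-$s$ ghosts $c^{\alpha_s}=\Phi^{\alpha_s}$ ($0\le s\le L$), with ghost number $\mathrm{gh}(\Phi^{\alpha_s})=s+1$ and Grassmann parity $\varepsilon_{\alpha_s}+s+1$. Each field has an antifield $\Phi^*_\alpha$ of opposite parity, with $\mathrm{gh}(\Phi^*_\alpha)=-\mathrm{gh}(\Phi^\alpha)-1$. The antifield number is $\mathrm{afn}(\Phi^\alpha)=0$, $\mathrm{afn}(\Phi^*_\alpha)=-\mathrm{gh}(\Phi^*_\alpha)$. Let $N=\sum_{s\ge -1}m_s$. Let $U$ be an open set in the space $\mathbb R^{p}$ of the Grassmann-even original fields. Functions on $U$ are formal power series in the ghosts, antifields and odd original fields (graded commuting) with coefficients in $C^\infty(U)$. With right and left derivatives, the antibracket is $$(f,g)=\sum_\alpha\left(\frac{\partial_r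 f}{\partial\Phi^\alpha}\frac{\partial_l g}{\partial\Phi^*_\alpha}-\frac{\partial_r f}{\partial\Phi^*_\alpha}\frac{\partial_l g}{\partial\Phi^\alpha}\right).$$ Let there be given an even action $S_0(\varphi)$ and structure functions $Z^{\alpha_{s-1}}{}_{\alpha_s}(\varphi)$, $0\le s\le L$ (with $Z^{\alpha_{-1}}{}_{\alpha_0}=R^i{}_{\alpha_0}$), of parity $\varepsilon_{\alpha_{s-1}}+\varepsilon_{\alpha_s}$. Put $M_s=\sum_{r\ge 0}(-1)^r m_{r+s}$ with $m_s=0$ for $s>L$. Assume that at every stationary point of $S_0$ in $U$ (odd fields put to zero) the Hessian of $S_0$ has rank $M_{-1}$ and the matrix $Z^{\alpha_{s-1}}{}_{\alpha_s}$ has rank $M_s$ for $0\le s\le L$. A *Koszul–Tate operator* is an operator $\mathbf s_{-1}=\sum_\alpha V_\alpha\,\partial_l/\partial\Phi^*_\alpha$, Grassmann-odd and of antifield number $-1$ (that is, $V_\alpha$ has parity $\varepsilon(\Phi^*_\alpha)+1$ and $\mathrm{afn}(V_\alpha)=\mathrm{afn}(\Phi^*_\alpha)-1$), with $V_\alpha=V_\alpha(\varphi,\Phi^*)$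 independent of the ghosts, $$V_i=\frac{\partial_r S_0}{\partial\varphi^i},\qquad V_{\alpha_s}=\sum_{\alpha_{s-1}}\Phi^*_{\alpha_{s-1}}Z^{\alpha_{s-1}}{}_{\alpha_s}+\mathcal O((\Phi^*)^2)\quad(0\le s\le L).$$ It is *nilpotent* if $\mathbf s_{-1}^2=0$, and *acyclic* if every function $f$ of definite antifield number $\mathrm{afn}(f)>0$ with $\mathbf s_{-1}f=0$ is of the form $f=\mathbf s_{-1}g$ for some function $g$. **Theorem.** Let $\mathbf s_{-1}=\sum_\alpha V_\alpha\,\partial_l/\partial\Phi^*_\alpha$ be a nilpotent, acyclic Koszul–Tate operator on $U$. Then there is a function $S$ on $U$ of the form $$S=S_0+\sum_{s=0}^L\sum_{\alpha_s}V_{\alpha_s}c^{\alpha_s}+\mathcal O(c^2)$$ that is a proper solution of the classical master equation on $U$, that is: $S$ is Grassmann-even, $\mathrm{gh}(S)=0$, $(S,S)=0$, $S=S_0+\mathcal O(\Phi^*)$, the terms of $S$ of total order at most two in the ghosts and antifields are $S_0+\sum_{s=0}^L\sum_{\alpha_{s-1},\alpha_s}\Phi^*_{\alpha_{s-1}}Z^{\alpha_{s-1}}{}_{\alpha_s}c^{\alpha_s}$,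 and at every stationary point of $S_0$ in $U$, with all ghosts and antifields (and odd original fields) put to zero, the Hessian of $S$ with respect to all $2N$ fields and antifields has rank $N$. -/

import Mathlib

open scoped ContDiff
open TopologicalSpace

noncomputable section

namespace BV

section Smooth

variable {ι : Type}

/-- Extension by zero of a function on the open set `U`. -/
def extendZero (U : Opens (ι → ℝ)) (f : U → ℝ) : (ι → ℝ) → ℝ :=
  Function.extend Subtype.val f 0

theorem extendZero_apply (U : Opens (ι → ℝ)) (f : U → ℝ) (x : U) :
    extendZero U f x = f x :=
  Subtype.val_injective.extend_apply f 0 x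

variable [Fintype ι]

/-- The algebra `C^∞(U)` of smooth real functions on an open set `U` of `ℝ^ι`. -/
def Smooth (U : Opens (ι → ℝ)) : Subalgebra ℝ (U → ℝ) where
  carrier := {f | ContDiffOn ℝ ∞ (extendZero U f) U}
  mul_mem' {f g} hf hg :=
    (ContDiffOn.mul hf hg).congr fun x hx => by
      simp [extendZero_apply U _ ⟨x, hx⟩, Pi.mul_apply]
  add_mem' {f g} hf hg :=
    (ContDiffOn.add hf hg).congr fun x hx => by
      simp [extendZero_apply U _ ⟨x, hx⟩, Pi.add_apply]
  algebraMap_mem' c :=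
    (contDiffOn_const (c := c)).congr fun x hx => by
      simp [extendZero_apply U _ ⟨x, hx⟩]

/-- The partial derivative `∂f/∂x_i` of a smooth function on `U`. -/
def Smooth.partialDeriv {U : Opens (ι → ℝ)} [DecidableEq ι] (i : ι) (f : Smooth U) : Smooth U :=
  ⟨fun x => fderiv ℝ (extendZero U f.1) x (Pi.single i 1), by
    have hf : ContDiffOn ℝ ∞ (extendZero U f.1) U := f.2
    have h : ContDiffOn ℝ ∞ (fderiv ℝ (extendZero U f.1)) U :=
      hf.fderiv_of_isOpen U.isOpen (by simp)
    exact (h.clm_apply contDiffOn_const).congr fun x hx =>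
      extendZero_apply U _ ⟨x, hx⟩⟩

end Smooth

/-- The minimal field content of a gauge theory of reducibility stage `L`.  The index
`k : Fin (L + 2)` is the *level* `k = s + 1` of the stage `s ∈ {-1, 0, …, L}`: level `0` are the
original fields `φ^i`, level `s + 1` the stage-`s` ghosts.  `m k` is the multiplicity `m_{k-1}`
and `ε k a ∈ ℤ/2` the number `ε_{α_s}` attached to the index `α_s = a`. -/
structure FieldContent where
  L : ℕ
  m : Fin (L + 2) → ℕ
  ε : (k : Fin (L + 2)) → Fin (m k) → ZMod 2

namespace FieldContent

variable (X : FieldContent)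

/-- The index set of the fields `Φ^α` (ordered lexicographically). -/
abbrev Field : Type := Σₗ k : Fin (X.L + 2), Fin (X.m k)

/-- The index set of all variables `Γ^A = {Φ^α ; Φ*_α}` (fields first, then antifields). -/
abbrev Var : Type := X.Field ⊕ₗ X.Field

variable {X}

/-- The index `α` with level `k` and position `a` in that level. -/
def mkField (k : Fin (X.L + 2)) (a : Fin (X.m k)) : X.Field := toLex ⟨k, a⟩

/-- The level (stage plus one) of a field index; it is the ghost number of `Φ^α`. -/
def level (α : X.Field) : Fin (X.L + 2) := (ofLex α).1

/-- The number `ε_{α_s}` attached to the field index `α`. -/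
def epsilon (α : X.Field) : ZMod 2 := X.ε (ofLex α).1 (ofLex α).2

/-- The variable `Φ^α`. -/
def fld (α : X.Field) : X.Var := Sum.inlₗ α

/-- The variable `Φ*_α`. -/
def anti (α : X.Field) : X.Var := Sum.inrₗ α

/-- The Grassmann parity of `Φ^α`: `ε_i` for `φ^i`, and `ε_{α_s} + s + 1` for `c^{α_s}`. -/
def fieldParity (α : X.Field) : ZMod 2 := epsilon α + ((level α : ℕ) : ZMod 2)

/-- The Grassmann parity of `Γ^A`; an antifield has the parity opposite to its field. -/
def parity (A : X.Var) : ZMod 2 :=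
  Sum.elim (fun α => fieldParity α) (fun α => fieldParity α + 1) (ofLex A)

/-- The ghost number: `gh(Φ^α) = level α` and `gh(Φ*_α) = - gh(Φ^α) - 1`. -/
def ghost (A : X.Var) : ℤ :=
  Sum.elim (fun α => ((level α : ℕ) : ℤ)) (fun α => -((level α : ℕ) : ℤ) - 1) (ofLex A)

/-- The antifield number: `afn(Φ^α) = 0` and `afn(Φ*_α) = - gh(Φ*_α) = level α + 1`. -/
def antifieldNumber (A : X.Var) : ℕ :=
  Sum.elim (fun _ => 0) (fun α => (level α : ℕ) + 1) (ofLex A)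

/-- `Γ^A` is a ghost `c^{α_s}`, `s ≥ 0`. -/
def IsGhost (A : X.Var) : Prop := ∃ α : X.Field, A = fld α ∧ level α ≠ 0

/-- `Γ^A` is an antifield `Φ*_α`. -/
def IsAntifield (A : X.Var) : Prop := ∃ α : X.Field, A = anti α

/-- `Γ^A` is a Grassmann-even original field, that is, a genuine real coordinate. -/
def IsReal (A : X.Var) : Prop := ∃ α : X.Field, A = fld α ∧ level α = 0 ∧ epsilon α = 0

instance decidableIsReal : DecidablePred (IsReal (X := X)) := fun _ => Classical.propDecidable _

variable (X) in
/-- The space of (bodies of) points `φ`, with the even original fields as coordinates. -/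
abbrev Body : Type := {A : X.Var // IsReal A} → ℝ

/-- An exponent `e` is admissible if it belongs to a monomial `∏_A (Γ^A)^{e_A}` in the formal
variables: no real coordinate occurs in it, and odd variables occur at most once. -/
def Admissible (e : X.Var →₀ ℕ) : Prop :=
  ∀ A, (IsReal A → e A = 0) ∧ (parity A = 1 → e A ≤ 1)

open Classical in
/-- The number of ghosts in a monomial. -/
def numGhosts (e : X.Var →₀ ℕ) : ℕ := ∑ A, if IsGhost A then e A else 0

open Classical in
/-- The number of antifields in a monomial. -/
def numAntifields (e : X.Var →₀ ℕ) : ℕ := ∑ A, if IsAntifield A then e A else 0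

/-- The antifield number of a monomial. -/
def afnDegree (e : X.Var →₀ ℕ) : ℕ := ∑ A, e A * antifieldNumber A

/-- The ghost number of a monomial. -/
def ghDegree (e : X.Var →₀ ℕ) : ℤ := ∑ A, (e A : ℤ) * ghost A

/-- The Grassmann parity of a monomial. -/
def parityDegree (e : X.Var →₀ ℕ) : ZMod 2 := ∑ A, (e A : ZMod 2) * parity A

/-- The sign in `Γ^a Γ^b = ± Γ^(a+b)`, where the factors of a monomial `Γ^e` are written in
increasing order: one factor `-1` for each pair of odd variables that has to be exchanged. -/
def mulSign (a b : X.Var →₀ ℕ) : ℝ :=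
  (-1) ^ (∑ A, ∑ B, if B < A ∧ parity A = 1 ∧ parity B = 1 then a A * b B else 0)

/-- The sign from moving `Γ^A` to the left end of the monomial `Γ^A Γ^e`. -/
def leftSign (A : X.Var) (e : X.Var →₀ ℕ) : ℝ :=
  (-1) ^ (∑ B, if B < A ∧ parity A = 1 ∧ parity B = 1 then e B else 0)

/-- The sign from moving `Γ^A` to the right end of the monomial `Γ^e Γ^A`. -/
def rightSign (A : X.Var) (e : X.Var →₀ ℕ) : ℝ :=
  (-1) ^ (∑ B, if A < B ∧ parity A = 1 ∧ parity B = 1 then e B else 0)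

variable (X) in
/-- The superfunctions `f = ∑_e f_e Γ^e` over `U`: formal power series in the ghosts, the
antifields and the odd original fields (in which `f` is at most linear if the variable is odd),
with coefficients `f_e` in `C^∞(U)`. -/
def Fun (U : Opens X.Body) : Submodule ℝ ((X.Var →₀ ℕ) → Smooth U) where
  carrier := {f | ∀ e, ¬ Admissible e → f e = 0}
  add_mem' {f g} hf hg e he := by simp [hf e he, hg e he]
  zero_mem' _ _ := rfl
  smul_mem' c f hf e he := by simp [hf e he]

variable {U : Opens X.Body}

open Classical in
/-- The superfunction with given coefficients on admissible exponents. -/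
def Fun.ofCoeff (f : (X.Var →₀ ℕ) → Smooth U) : X.Fun U :=
  ⟨fun e => if Admissible e then f e else 0, fun _ he => if_neg he⟩

/-- The graded-commutative product of superfunctions. -/
instance Fun.instMul : Mul (X.Fun U) where
  mul f g := Fun.ofCoeff fun e =>
    ∑ p ∈ Finset.HasAntidiagonal.antidiagonal e, mulSign p.1 p.2 • (f.1 p.1 * g.1 p.2)

open Classical in
/-- The variable `Γ^A` as a superfunction, for `A` not a real coordinate. -/
def gen (A : X.Var) : X.Fun U :=
  Fun.ofCoeff fun e => if e = Finsupp.single A 1 then 1 else 0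

open Classical in
/-- The left derivative `∂_l f / ∂Γ^A`. -/
def leftDeriv (A : X.Var) (f : X.Fun U) : X.Fun U :=
  Fun.ofCoeff fun e =>
    if h : IsReal A then Smooth.partialDeriv ⟨A, h⟩ (f.1 e)
    else (leftSign A e * ((e A : ℝ) + 1)) • f.1 (e + Finsupp.single A 1)

open Classical in
/-- The right derivative `f ∂_r / ∂Γ^A`. -/
def rightDeriv (A : X.Var) (f : X.Fun U) : X.Fun U :=
  Fun.ofCoeff fun e =>
    if h : IsReal A then Smooth.partialDeriv ⟨A, h⟩ (f.1 e)
    else (rightSign A e * ((e A : ℝ) + 1)) • f.1 (e + Finsupp.single A 1)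

/-- The antibracket
`(f, g) = f (∂_r/∂Φ^α ∂_l/∂Φ*_α - ∂_r/∂Φ*_α ∂_l/∂Φ^α) g`. -/
def antibracket (f g : X.Fun U) : X.Fun U :=
  ∑ α : X.Field, (rightDeriv (fld α) f * leftDeriv (anti α) g
    - rightDeriv (anti α) f * leftDeriv (fld α) g)

/-- `f` has Grassmann parity `p`. -/
def HasParity (f : X.Fun U) (p : ZMod 2) : Prop := ∀ e, f.1 e ≠ 0 → parityDegree e = p

/-- `f` has ghost number `n`. -/
def HasGh (f : X.Fun U) (n : ℤ) : Prop := ∀ e, f.1 e ≠ 0 → ghDegree e = n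

/-- `f` has antifield number `r`. -/
def HasAfn (f : X.Fun U) (r : ℕ) : Prop := ∀ e, f.1 e ≠ 0 → afnDegree e = r

/-- `f = O(c^k)`. -/
def IsOGhost (k : ℕ) (f : X.Fun U) : Prop := ∀ e, f.1 e ≠ 0 → k ≤ numGhosts e

/-- `f = O((Φ*)^k)`. -/
def IsOAntifield (k : ℕ) (f : X.Fun U) : Prop := ∀ e, f.1 e ≠ 0 → k ≤ numAntifields e

/-- `f` is at least of order `k` in the auxiliary variables (ghosts and antifields). -/
def IsOAux (k : ℕ) (f : X.Fun U) : Prop := ∀ e, f.1 e ≠ 0 → k ≤ numGhosts e + numAntifields e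

/-- `f = f(φ, Φ*)` does not depend on the ghosts. -/
def GhostFree (f : X.Fun U) : Prop := ∀ e, f.1 e ≠ 0 → numGhosts e = 0

/-- `f = f(φ)` depends on the original fields only. -/
def OriginalOnly (f : X.Fun U) : Prop := ∀ e, f.1 e ≠ 0 → numGhosts e = 0 ∧ numAntifields e = 0

/-- The value of `f` at the point `x`, with all formal variables put to zero. -/
def value (f : X.Fun U) (x : U) : ℝ := (f.1 0).1 x

/-- The Hessian `∂_l/∂Γ^A f ∂_r/∂Γ^B` at the point `x`, with all formal variables put to zero. -/
def hessian (f : X.Fun U) (x : U) : Matrix X.Var X.Var ℝ :=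
  Matrix.of fun A B => value (leftDeriv A (rightDeriv B f)) x

/-- `x` lies on the stationary surface of the original action. -/
def IsStationary (S₀ : X.Fun U) (x : U) : Prop :=
  ∀ i : Fin (X.m 0), value (rightDeriv (fld (mkField 0 i)) S₀) x = 0

variable (X U) in
/-- Families `Z^{α_{s-1}}_{α_s}`, `s = 0, …, L` (with `Z^i_{α_0} = R^i_{α_0}`). -/
abbrev Generators : Type :=
  (s : Fin (X.L + 1)) → Fin (X.m s.castSucc) → Fin (X.m s.succ) → X.Fun U

variable (X) in
/-- The numbers `M_s = ∑_{r ≥ 0} (-1)^r m_{r+s}`, at level `k = s + 1`. -/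
def rankM (k : Fin (X.L + 2)) : ℤ :=
  ∑ j ∈ Finset.Ici k, (-1) ^ ((j : ℕ) - (k : ℕ)) * (X.m j : ℤ)

/-- The starting point: an even action `S₀(φ)` and structure functions `Z^{α_{s-1}}_{α_s}(φ)` of
parity `ε_{α_{s-1}} + ε_{α_s}`, with the rank conditions on the stationary surface. -/
structure IsGaugeTheory (S₀ : X.Fun U) (Z : Generators X U) : Prop where
  action_original : OriginalOnly S₀
  action_even : HasParity S₀ 0
  gen_original : ∀ s a b, OriginalOnly (Z s a b)
  gen_parity : ∀ s a b, HasParity (Z s a b) (X.ε s.castSucc a + X.ε s.succ b)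
  rank_hessian : ∀ x : U, IsStationary S₀ x →
    (((hessian S₀ x).submatrix (fun i : Fin (X.m 0) => fld (mkField 0 i))
      (fun i : Fin (X.m 0) => fld (mkField 0 i))).rank : ℤ) = X.rankM 0
  rank_gen : ∀ x : U, IsStationary S₀ x → ∀ s : Fin (X.L + 1),
    ((Matrix.of fun a b => value (Z s a b) x).rank : ℤ) = X.rankM s.succ

/-- The operator `V_α ∂_l/∂Φ*_α`. -/
def ktOperator (V : X.Field → X.Fun U) (f : X.Fun U) : X.Fun U :=
  ∑ α : X.Field, V α * leftDeriv (anti α) f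

/-- `V_α ∂_l/∂Φ*_α` has the form of a Koszul–Tate operator for the gauge theory `(S₀, Z)`:
it is odd, has antifield number `-1`, the `V_α` do not depend on the ghosts,
`V_i = S₀ ∂_r/∂φ^i` and `V_{α_s} = Φ*_{α_{s-1}} Z^{α_{s-1}}_{α_s} + O((Φ*)²)`, `s = 0, …, L`. -/
structure IsKoszulTate (S₀ : X.Fun U) (Z : Generators X U) (V : X.Field → X.Fun U) : Prop where
  ghostFree : ∀ α, GhostFree (V α)
  parity_eq : ∀ α, HasParity (V α) (parity (anti α) + 1)
  afn_eq : ∀ α, HasAfn (V α) (antifieldNumber (anti α) - 1)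
  original : ∀ i : Fin (X.m 0), V (mkField 0 i) = rightDeriv (fld (mkField 0 i)) S₀
  linear : ∀ (s : Fin (X.L + 1)) (b : Fin (X.m s.succ)),
    IsOAntifield 2 (V (mkField s.succ b)
      - ∑ a : Fin (X.m s.castSucc), gen (anti (mkField s.castSucc a)) * Z s a b)

/-- Nilpotency of the operator `V_α ∂_l/∂Φ*_α`. -/
def IsNilpotentKT (V : X.Field → X.Fun U) : Prop :=
  ∀ f : X.Fun U, ktOperator V (ktOperator V f) = 0

/-- Acyclicity of the operator `V_α ∂_l/∂Φ*_α` in positive antifield number. -/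
def IsAcyclicKT (V : X.Field → X.Fun U) : Prop :=
  ∀ (r : ℕ) (f : X.Fun U), 0 < r → HasAfn f r → ktOperator V f = 0 →
    ∃ g : X.Fun U, f = ktOperator V g

/-- `S` is a proper solution of the classical master equation for the gauge theory `(S₀, Z)`. -/
structure IsProperSolution (S₀ : X.Fun U) (Z : Generators X U) (S : X.Fun U) : Prop where
  even : HasParity S 0
  gh_zero : HasGh S 0
  master : antibracket S S = 0
  original_limit : IsOAntifield 1 (S - S₀)
  proper : ∀ x : U, IsStationary S₀ x → (hessian S x).rank = Fintype.card X.Field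
  quad : IsOAux 3 (S - (S₀ + ∑ s : Fin (X.L + 1), ∑ a : Fin (X.m s.castSucc),
    ∑ b : Fin (X.m s.succ),
      gen (anti (mkField s.castSucc a)) * Z s a b * gen (fld (mkField s.succ b))))

end FieldContent

end BV

end

/-! The action is built by homological perturbation theory, order by order in the antifield number.
Write δ for the Koszul–Tate operator. The sum of ghost number and antifield number receives
contributions from ghosts only and bounds their number from above (`numGhosts_le`); nearly all
degree estimates come from this.

Start from S = S₀ + V c. Here δS₀ = 0 because S₀ contains no antifields, and δ(V c) = (δV) c = 0
because V_α = δΦ*_α and δ² = 0. For every even S = S₀ + V c + O(c²) of ghost number 0, this makes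
(S,S) quadratic in the ghosts (`IsExtension.antibracket_ghosts`). As (S,S) has ghost number 1, its
antifield number is at least 1, exactly the range in which δ is acyclic. Moreover (S,·) is δ up to
terms that do not lower the antifield number (`IsExtension.antibracket_sub_kt`).

Suppose that (S,S) starts at antifield number r, with lowest part B. The Jacobi identity (S,(S,S)) =
0 (`antibracket_antibracket_self`) has δB as its part at antifield number r - 1, so δB = 0 and B =
δg. Since δ shifts every degree by a fixed amount, g can be cut down to an even function of ghost
number 0, antifield number r + 1 and at least two ghosts (`exists_homogeneous_primitive`). Then 2(S,
-g/2) cancels B, and S - g/2 solves the equation one order further (`IsExtension.exists_next`). The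
corrections have increasing antifield number, so each coefficient stabilises; one bracket lowers the
antifield number by at most L + 2, so the limit solves the equation exactly (`exists_master`).

Properness is a count. A term of ghost number 0 with two or more ghosts contains an antifield, hence
has order at least three in ghosts and antifields. So the Hessian sees only S₀ and the terms Φ* Z c.
It splits into the Hessian of S₀, the matrices Z, and their transposes up to signs of rows. Its rank
is M_{-1} + 2 ∑_{s ≥ 0} M_s, which equals N because M_s + M_{s+1} = m_s (`sum_rankM`,
`rank_hessian_eq`).

Underneath lies the sign calculus of the graded algebra. All signs are values of one bilinear form
over `ZMod 2` on exponents (`pairing`), whose symmetrisation on admissible exponents is the product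
of parities (`pairing_swap`). Associativity, graded commutativity, the Leibniz rule and the
commutation of derivatives follow from this. -/

noncomputable section

namespace BV.FieldContent

variable {X : FieldContent} {U : Opens X.Body}

/-! ### Signs -/

/-- The character `p ↦ (-1)^p` of `ℤ/2`. -/
def sgn (p : ZMod 2) : ℝ := if p = 0 then 1 else -1

theorem sgn_zero : sgn 0 = 1 := if_pos rfl

theorem sgn_one : sgn 1 = -1 := if_neg one_ne_zero

theorem sgn_add (p q : ZMod 2) : sgn (p + q) = sgn p * sgn q := by
  revert p q
  have h : ∀ p : ZMod 2, p = 0 ∨ p = 1 := by decide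
  intro p q
  rcases h p with rfl | rfl <;> rcases h q with rfl | rfl <;>
    simp [sgn_zero, sgn_one, show (1 : ZMod 2) + 1 = 0 from rfl]

theorem sgn_mul_self (p : ZMod 2) : sgn p * sgn p = 1 := by
  rw [← sgn_add, CharTwo.add_self_eq_zero, sgn_zero]

theorem sgn_natCast (n : ℕ) : sgn n = (-1) ^ n := by
  induction n with
  | zero => simp [sgn_zero]
  | succ n ih => rw [Nat.cast_succ, sgn_add, ih, sgn_one, pow_succ]

theorem zmod_two_mul_self (p : ZMod 2) : p * p = p := by revert p; decide

/-- The bilinear form whose value is the exponent of `mulSign`. -/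
def pairing (a b : X.Var →₀ ℕ) : ZMod 2 :=
  ∑ A, ∑ B, if B < A then (a A : ZMod 2) * b B * (parity A * parity B) else 0

theorem pairing_add_left (a b c : X.Var →₀ ℕ) : pairing (a + b) c = pairing a c + pairing b c := by
  simp only [pairing, ← Finset.sum_add_distrib]
  refine Finset.sum_congr rfl fun A _ => Finset.sum_congr rfl fun B _ => ?_
  split_ifs
  · rw [Finsupp.add_apply]; push_cast; ring
  · simp

theorem pairing_add_right (a b c : X.Var →₀ ℕ) :
    pairing a (b + c) = pairing a b + pairing a c := by
  simp only [pairing, ← Finset.sum_add_distrib]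
  refine Finset.sum_congr rfl fun A _ => Finset.sum_congr rfl fun B _ => ?_
  split_ifs
  · rw [Finsupp.add_apply]; push_cast; ring
  · simp

/-- Over `ZMod 2` the product of two parities is the indicator that both are odd. This turns the
case distinctions in the sign exponents into a bilinear expression. -/
theorem cast_ite_parity (A B : X.Var) (n : ℕ) :
    ((if B < A ∧ parity A = 1 ∧ parity B = 1 then n else 0 : ℕ) : ZMod 2) =
      if B < A then (n : ZMod 2) * (parity A * parity B) else 0 := by
  have h : ∀ p : ZMod 2, p = 0 ∨ p = 1 := by decide
  rcases h (parity A) with hA | hA <;> rcases h (parity B) with hB | hB <;> simp [hA, hB]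

theorem mulSign_eq (a b : X.Var →₀ ℕ) : mulSign a b = sgn (pairing a b) := by
  rw [mulSign, ← sgn_natCast]
  congr 1
  simp only [Nat.cast_sum, pairing]
  refine Finset.sum_congr rfl fun A _ => Finset.sum_congr rfl fun B _ => ?_
  rw [cast_ite_parity, Nat.cast_mul]

open Classical in
theorem leftSign_eq (A : X.Var) (e : X.Var →₀ ℕ) :
    leftSign A e = sgn (pairing (Finsupp.single A 1) e) := by
  rw [leftSign, ← sgn_natCast]
  congr 1
  simp only [Nat.cast_sum, pairing]
  refine Eq.trans ?_ (Finset.sum_eq_single A ?_ ?_).symm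
  · refine Finset.sum_congr rfl fun B _ => ?_
    rw [cast_ite_parity]; simp
  · intro B _ hB
    simp [Finsupp.single_eq_of_ne hB]
  · simp

open Classical in
theorem rightSign_eq (A : X.Var) (e : X.Var →₀ ℕ) :
    rightSign A e = sgn (pairing e (Finsupp.single A 1)) := by
  rw [rightSign, ← sgn_natCast]
  congr 1
  simp only [Nat.cast_sum, pairing]
  refine Finset.sum_congr rfl fun B _ => ?_
  rw [Finset.sum_eq_single A]
  · simp only [and_comm (a := parity A = 1)]
    rw [cast_ite_parity]; simp
  · intro C _ hC
    simp [Finsupp.single_eq_of_ne hC]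
  · simp

/-! ### Admissible exponents -/

theorem Admissible.mono {a b : X.Var →₀ ℕ} (h : Admissible b) (hab : a ≤ b) : Admissible a :=
  fun A => ⟨fun hA => Nat.le_zero.1 (((h A).1 hA) ▸ hab A), fun hA => (hab A).trans ((h A).2 hA)⟩

theorem Admissible.left {a b : X.Var →₀ ℕ} (h : Admissible (a + b)) : Admissible a :=
  h.mono le_self_add

theorem Admissible.right {a b : X.Var →₀ ℕ} (h : Admissible (a + b)) : Admissible b :=
  h.mono le_add_self

theorem coeff_eq_zero (f : X.Fun U) {e : X.Var →₀ ℕ} (h : ¬ Admissible e) : f.1 e = 0 := f.2 e h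

theorem admissible_of_coeff_ne (f : X.Fun U) {e : X.Var →₀ ℕ} (h : f.1 e ≠ 0) : Admissible e :=
  by_contra fun h' => h (f.2 e h')

theorem parityDegree_add (a b : X.Var →₀ ℕ) :
    parityDegree (a + b) = parityDegree a + parityDegree b := by
  simp only [parityDegree, ← Finset.sum_add_distrib, Finsupp.add_apply, Nat.cast_add, add_mul]

/-- Exchanging the factors of a product of monomials. -/
theorem pairing_swap {a b : X.Var →₀ ℕ} (h : Admissible (a + b)) :
    pairing a b + pairing b a = parityDegree a * parityDegree b := by
  have h2 : ∀ p : ZMod 2, p = 0 ∨ p = 1 := by decide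
  rw [parityDegree, parityDegree, Finset.sum_mul_sum, pairing, pairing,
    Finset.sum_comm (f := fun A B =>
      if B < A then (b A : ZMod 2) * a B * (parity A * parity B) else 0)]
  simp only [← Finset.sum_add_distrib]
  refine Finset.sum_congr rfl fun A _ => Finset.sum_congr rfl fun B _ => ?_
  rcases lt_trichotomy A B with hAB | rfl | hAB
  · rw [if_neg hAB.not_gt, if_pos hAB]; ring
  · rw [if_neg (lt_irrefl _)]
    rcases h2 (parity A) with hA | hA
    · simp [hA]
    -- The diagonal is where admissibility enters: an odd variable cannot occur in both factors, so
    -- its contribution to the product of parities vanishes.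
    · have := (h A).2 hA
      rw [Finsupp.add_apply] at this
      have : a A = 0 ∨ b A = 0 := by omega
      rcases this with h0 | h0 <;> simp [h0]
  · rw [if_pos hAB, if_neg hAB.not_gt]; ring

/-! ### The product -/

theorem fun_ext {f g : X.Fun U} (h : ∀ e, f.1 e = g.1 e) : f = g := Subtype.ext (funext h)

theorem coeff_add (f g : X.Fun U) (e : X.Var →₀ ℕ) : (f + g).1 e = f.1 e + g.1 e := rfl

theorem coeff_sub (f g : X.Fun U) (e : X.Var →₀ ℕ) : (f - g).1 e = f.1 e - g.1 e := rfl

theorem coeff_zero (e : X.Var →₀ ℕ) : (0 : X.Fun U).1 e = 0 := rfl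

theorem coeff_smul (c : ℝ) (f : X.Fun U) (e : X.Var →₀ ℕ) : (c • f).1 e = c • f.1 e := rfl

/-- The coefficient of a monomial, as a linear map. -/
def coeffₗ (e : X.Var →₀ ℕ) : X.Fun U →ₗ[ℝ] Smooth U where
  toFun f := f.1 e
  map_add' _ _ := rfl
  map_smul' _ _ := rfl

theorem coeff_sum {ι : Type*} (s : Finset ι) (f : ι → X.Fun U) (e : X.Var →₀ ℕ) :
    (∑ i ∈ s, f i).1 e = ∑ i ∈ s, (f i).1 e := map_sum (coeffₗ e) f s

theorem coeff_ofCoeff (f : (X.Var →₀ ℕ) → Smooth U) {e : X.Var →₀ ℕ} (he : Admissible e) :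
    (Fun.ofCoeff f).1 e = f e := if_pos he

theorem coeff_mul (f g : X.Fun U) {e : X.Var →₀ ℕ} (he : Admissible e) :
    (f * g).1 e = ∑ p ∈ Finset.HasAntidiagonal.antidiagonal e,
      mulSign p.1 p.2 • (f.1 p.1 * g.1 p.2) := if_pos he

/-- A monomial of a product splits into monomials of the factors; additive degrees of products are
always read off through this. -/
theorem exists_of_coeff_mul_ne {f g : X.Fun U} {e : X.Var →₀ ℕ} (h : (f * g).1 e ≠ 0) :
    ∃ a b, a + b = e ∧ f.1 a ≠ 0 ∧ g.1 b ≠ 0 := by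
  have he := admissible_of_coeff_ne _ h
  rw [coeff_mul f g he] at h
  obtain ⟨p, hp, hne⟩ := Finset.exists_ne_zero_of_sum_ne_zero h
  refine ⟨p.1, p.2, Finset.HasAntidiagonal.mem_antidiagonal.1 hp, ?_, ?_⟩ <;>
  · intro h0; simp [h0] at hne

theorem fun_smul_add (c : ℝ) (f g : X.Fun U) : c • (f + g) = c • f + c • g :=
  fun_ext fun e => by rw [coeff_smul, coeff_add, coeff_add, coeff_smul, coeff_smul, smul_add]

theorem fun_add_smul (c d : ℝ) (f : X.Fun U) : (c + d) • f = c • f + d • f :=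
  fun_ext fun e => by rw [coeff_smul, coeff_add, coeff_smul, coeff_smul, add_smul]

theorem fun_smul_smul (c d : ℝ) (f : X.Fun U) : c • d • f = (c * d) • f :=
  fun_ext fun e => by rw [coeff_smul, coeff_smul, coeff_smul, smul_smul]

theorem fun_one_smul (f : X.Fun U) : (1 : ℝ) • f = f :=
  fun_ext fun e => by rw [coeff_smul, one_smul]

theorem fun_sub_eq (f g : X.Fun U) : f - g = f + (-1 : ℝ) • g :=
  fun_ext fun e => by rw [coeff_sub, coeff_add, coeff_smul, neg_one_smul, sub_eq_add_neg]

theorem fun_add_sub_cancel_left (f g : X.Fun U) : f + g - f = g :=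
  fun_ext fun e => by rw [coeff_sub, coeff_add, add_sub_cancel_left]

theorem fun_add_sub_cancel_right (f g : X.Fun U) : f + g - g = f :=
  fun_ext fun e => by rw [coeff_sub, coeff_add, add_sub_cancel_right]

theorem fun_add_sub_cancel (f g : X.Fun U) : f + (g - f) = g :=
  fun_ext fun e => by rw [coeff_add, coeff_sub, add_sub_cancel]

theorem fun_sub_add_sub_cancel (f g h : X.Fun U) : f - g + (g - h) = f - h :=
  fun_ext fun e => by rw [coeff_add, coeff_sub, coeff_sub, coeff_sub, sub_add_sub_cancel]

theorem fun_sub_right_comm (f g h : X.Fun U) : f - g - h = f - h - g :=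
  fun_ext fun e => by simp only [coeff_sub, sub_right_comm]

theorem fun_sub_zero (f : X.Fun U) : f - 0 = f :=
  fun_ext fun e => by rw [coeff_sub, coeff_zero, sub_zero]

theorem fun_smul_zero (c : ℝ) : c • (0 : X.Fun U) = 0 :=
  fun_ext fun e => by rw [coeff_smul, coeff_zero, smul_zero]

theorem fun_sum_sub {ι : Type*} (s : Finset ι) (f g : ι → X.Fun U) :
    ∑ i ∈ s, f i - ∑ i ∈ s, g i = ∑ i ∈ s, (f i - g i) :=
  fun_ext fun e => by simp only [coeff_sub, coeff_sum, Finset.sum_sub_distrib]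

theorem fun_smul_sum {ι : Type*} (c : ℝ) (s : Finset ι) (f : ι → X.Fun U) :
    c • ∑ i ∈ s, f i = ∑ i ∈ s, c • f i :=
  fun_ext fun e => by simp only [coeff_smul, coeff_sum, Finset.smul_sum]

theorem fun_sum_add {ι : Type*} (s : Finset ι) (f g : ι → X.Fun U) :
    ∑ i ∈ s, (f i + g i) = ∑ i ∈ s, f i + ∑ i ∈ s, g i := Finset.sum_add_distrib

/-- The product as a bilinear map. -/
def mulₗ : X.Fun U →ₗ[ℝ] X.Fun U →ₗ[ℝ] X.Fun U :=
  LinearMap.mk₂ ℝ (· * ·)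
    (fun f f' g => fun_ext fun e => by
      by_cases he : Admissible e
      · simp only [coeff_add, coeff_mul _ _ he, add_mul, smul_add, Finset.sum_add_distrib]
      · rw [coeff_add, coeff_eq_zero _ he, coeff_eq_zero _ he, coeff_eq_zero _ he, add_zero])
    (fun c f g => fun_ext fun e => by
      by_cases he : Admissible e
      · rw [coeff_smul, coeff_mul _ _ he, coeff_mul _ _ he, Finset.smul_sum]
        exact Finset.sum_congr rfl fun _ _ => by rw [coeff_smul, smul_mul_assoc, smul_comm]
      · rw [coeff_smul, coeff_eq_zero _ he, coeff_eq_zero _ he, smul_zero])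
    (fun f g g' => fun_ext fun e => by
      by_cases he : Admissible e
      · simp only [coeff_add, coeff_mul _ _ he, mul_add, smul_add, Finset.sum_add_distrib]
      · rw [coeff_add, coeff_eq_zero _ he, coeff_eq_zero _ he, coeff_eq_zero _ he, add_zero])
    (fun c f g => fun_ext fun e => by
      by_cases he : Admissible e
      · rw [coeff_smul, coeff_mul _ _ he, coeff_mul _ _ he, Finset.smul_sum]
        exact Finset.sum_congr rfl fun _ _ => by rw [coeff_smul, mul_smul_comm, smul_comm]
      · rw [coeff_smul, coeff_eq_zero _ he, coeff_eq_zero _ he, smul_zero])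

theorem fun_add_mul (f f' g : X.Fun U) : (f + f') * g = f * g + f' * g :=
  (mulₗ (X := X) (U := U)).map_add₂ f f' g

theorem fun_mul_add (f g g' : X.Fun U) : f * (g + g') = f * g + f * g' :=
  (mulₗ f).map_add g g'

theorem fun_smul_mul (c : ℝ) (f g : X.Fun U) : (c • f) * g = c • (f * g) :=
  (mulₗ (X := X) (U := U)).map_smul₂ c f g

theorem fun_sub_mul (f f' g : X.Fun U) : (f - f') * g = f * g - f' * g := by
  rw [fun_sub_eq, fun_sub_eq, fun_add_mul, fun_smul_mul]

theorem fun_mul_smul (c : ℝ) (f g : X.Fun U) : f * (c • g) = c • (f * g) :=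
  (mulₗ f).map_smul c g

theorem fun_mul_zero (f : X.Fun U) : f * 0 = 0 := (mulₗ f).map_zero

theorem fun_zero_mul (f : X.Fun U) : 0 * f = 0 := (mulₗ (X := X) (U := U)).map_zero₂ f

theorem fun_sum_mul {ι : Type*} (s : Finset ι) (f : ι → X.Fun U) (g : X.Fun U) :
    (∑ i ∈ s, f i) * g = ∑ i ∈ s, f i * g :=
  map_sum ((mulₗ (X := X) (U := U)).flip g) f s

theorem fun_mul_sum {ι : Type*} (s : Finset ι) (f : X.Fun U) (g : ι → X.Fun U) :
    f * (∑ i ∈ s, g i) = ∑ i ∈ s, f * g i :=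
  map_sum (mulₗ f) g s

/-- The exponent of the sign is bilinear, so both bracketings of a triple (a, b, c) carry the
exponent `pairing a b + pairing a c + pairing b c`; the rest is the reindexing of triples with a
given sum. -/
theorem fun_mul_assoc (f g h : X.Fun U) : f * g * h = f * (g * h) := by
  refine fun_ext fun e => ?_
  by_cases he : Admissible e
  swap
  · rw [coeff_eq_zero _ he, coeff_eq_zero _ he]
  rw [coeff_mul _ _ he, coeff_mul _ _ he]
  have h1 : ∀ p ∈ Finset.HasAntidiagonal.antidiagonal e,
      mulSign p.1 p.2 • ((f * g).1 p.1 * h.1 p.2) =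
      ∑ q ∈ Finset.HasAntidiagonal.antidiagonal p.1,
        (mulSign (q.1 + q.2) p.2 * mulSign q.1 q.2) • (f.1 q.1 * g.1 q.2 * h.1 p.2) := by
    intro p hp
    rw [Finset.HasAntidiagonal.mem_antidiagonal] at hp
    rw [coeff_mul _ _ (he.mono (hp ▸ le_self_add) : Admissible p.1), Finset.sum_mul,
      Finset.smul_sum]
    refine Finset.sum_congr rfl fun q hq => ?_
    rw [Finset.HasAntidiagonal.mem_antidiagonal] at hq
    rw [hq, smul_mul_assoc, smul_smul]
  have h2 : ∀ p ∈ Finset.HasAntidiagonal.antidiagonal e,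
      mulSign p.1 p.2 • (f.1 p.1 * (g * h).1 p.2) =
      ∑ q ∈ Finset.HasAntidiagonal.antidiagonal p.2,
        (mulSign p.1 (q.1 + q.2) * mulSign q.1 q.2) • (f.1 p.1 * g.1 q.1 * h.1 q.2) := by
    intro p hp
    rw [Finset.HasAntidiagonal.mem_antidiagonal] at hp
    rw [coeff_mul _ _ (he.mono (hp ▸ le_add_self) : Admissible p.2), Finset.mul_sum,
      Finset.smul_sum]
    refine Finset.sum_congr rfl fun q hq => ?_
    rw [Finset.HasAntidiagonal.mem_antidiagonal] at hq
    rw [hq, mul_smul_comm, smul_smul, mul_assoc (f.1 p.1)]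
  rw [Finset.sum_congr rfl h1, Finset.sum_congr rfl h2, Finset.sum_sigma', Finset.sum_sigma']
  refine Finset.sum_nbij' (fun ⟨⟨_i, j⟩, ⟨k, l⟩⟩ => ⟨(k, l + j), (l, j)⟩)
    (fun ⟨⟨i, _j⟩, ⟨k, l⟩⟩ => ⟨(i + k, l), (i, k)⟩) ?_ ?_ ?_ ?_ ?_
  · rintro ⟨⟨i, j⟩, ⟨k, l⟩⟩ hx
    simp only [Finset.mem_sigma, Finset.HasAntidiagonal.mem_antidiagonal] at hx ⊢
    exact ⟨by rw [← add_assoc, hx.2, hx.1], trivial⟩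
  · rintro ⟨⟨i, j⟩, ⟨k, l⟩⟩ hx
    simp only [Finset.mem_sigma, Finset.HasAntidiagonal.mem_antidiagonal] at hx ⊢
    exact ⟨by rw [add_assoc, hx.2, hx.1], trivial⟩
  · rintro ⟨⟨i, j⟩, ⟨k, l⟩⟩ hx
    simp only [Finset.mem_sigma, Finset.HasAntidiagonal.mem_antidiagonal] at hx
    simp [hx.2]
  · rintro ⟨⟨i, j⟩, ⟨k, l⟩⟩ hx
    simp only [Finset.mem_sigma, Finset.HasAntidiagonal.mem_antidiagonal] at hx
    simp [hx.2]
  · rintro ⟨⟨i, j⟩, ⟨k, l⟩⟩ hx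
    congr 1
    simp only [mulSign_eq, pairing_add_left, pairing_add_right, sgn_add]
    ring

/-- Graded commutativity. -/
theorem mul_comm_of_parity {f g : X.Fun U} {p q : ZMod 2} (hf : HasParity f p)
    (hg : HasParity g q) : g * f = sgn (p * q) • (f * g) := by
  refine fun_ext fun e => ?_
  by_cases he : Admissible e
  swap
  · rw [coeff_eq_zero _ he, coeff_eq_zero _ he]
  rw [coeff_smul, coeff_mul _ _ he, coeff_mul _ _ he, Finset.smul_sum]
  refine (Finsupp.sum_antidiagonal_swap e fun a b => mulSign b a • (g.1 b * f.1 a)).symm.trans ?_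
  refine Finset.sum_congr rfl fun r hr => ?_
  rw [Finset.HasAntidiagonal.mem_antidiagonal] at hr
  by_cases h1 : f.1 r.1 = 0
  · simp [h1]
  by_cases h2 : g.1 r.2 = 0
  · simp [h2]
  rw [mul_comm (g.1 r.2), smul_smul, ← hf _ h1, ← hg _ h2,
    ← pairing_swap (hr ▸ he), mulSign_eq, mulSign_eq, sgn_add]
  congr 1
  linear_combination (-sgn (pairing r.2 r.1)) * sgn_mul_self (pairing r.1 r.2)

end BV.FieldContent

namespace BV

/-! ### Partial derivatives of smooth functions -/

namespace Smooth

variable {ι : Type} {U : Opens (ι → ℝ)}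

/-- Derivatives depend only on germs, and U is open: near a point of U the extension by zero may be
replaced by any function that agrees with f on U. -/
theorem extendZero_congr {f : U → ℝ} {g : (ι → ℝ) → ℝ} (h : ∀ y : U, f y = g y) (x : U) :
    extendZero U f =ᶠ[nhds (x : ι → ℝ)] g := by
  filter_upwards [U.isOpen.mem_nhds x.2] with y hy
  rw [extendZero_apply U f ⟨y, hy⟩, h]

variable [Fintype ι]

theorem differentiableAt_extendZero (f : Smooth U) (x : U) :
    DifferentiableAt ℝ (extendZero U f.1) x :=
  (f.2.contDiffAt (U.isOpen.mem_nhds x.2)).differentiableAt (by simp)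

variable [DecidableEq ι]

theorem partialDeriv_apply (i : ι) (f : Smooth U) (x : U) :
    (partialDeriv i f).1 x = fderiv ℝ (extendZero U f.1) x (Pi.single i 1) := rfl

theorem partialDeriv_add (i : ι) (f g : Smooth U) :
    partialDeriv i (f + g) = partialDeriv i f + partialDeriv i g := by
  refine Subtype.ext (funext fun x => ?_)
  have h : extendZero U (f + g).1 =ᶠ[nhds (x : ι → ℝ)] extendZero U f.1 + extendZero U g.1 :=
    extendZero_congr (fun y => by simp [extendZero_apply]) x
  change (partialDeriv i (f + g)).1 x = (partialDeriv i f).1 x + (partialDeriv i g).1 x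
  rw [partialDeriv_apply, h.fderiv_eq,
    fderiv_add (differentiableAt_extendZero f x) (differentiableAt_extendZero g x)]
  rfl

theorem partialDeriv_mul (i : ι) (f g : Smooth U) :
    partialDeriv i (f * g) = partialDeriv i f * g + f * partialDeriv i g := by
  refine Subtype.ext (funext fun x => ?_)
  have h : extendZero U (f * g).1 =ᶠ[nhds (x : ι → ℝ)] extendZero U f.1 * extendZero U g.1 :=
    extendZero_congr (fun y => by simp [extendZero_apply]) x
  change (partialDeriv i (f * g)).1 x =
    (partialDeriv i f).1 x * g.1 x + f.1 x * (partialDeriv i g).1 x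
  rw [partialDeriv_apply, h.fderiv_eq,
    fderiv_mul (differentiableAt_extendZero f x) (differentiableAt_extendZero g x)]
  simp only [add_apply, smul_apply, smul_eq_mul,
    extendZero_apply, partialDeriv_apply]
  ring

theorem partialDeriv_smul (i : ι) (c : ℝ) (f : Smooth U) :
    partialDeriv i (c • f) = c • partialDeriv i f := by
  refine Subtype.ext (funext fun x => ?_)
  have h : extendZero U (c • f).1 =ᶠ[nhds (x : ι → ℝ)] c • extendZero U f.1 :=
    extendZero_congr (fun y => by simp [extendZero_apply]) x
  change (partialDeriv i (c • f)).1 x = c * (partialDeriv i f).1 x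
  rw [partialDeriv_apply, h.fderiv_eq, fderiv_const_smul (differentiableAt_extendZero f x)]
  rfl

/-- The partial derivative as a linear map. -/
def partialDerivₗ (i : ι) : Smooth U →ₗ[ℝ] Smooth U where
  toFun := partialDeriv i
  map_add' := partialDeriv_add i
  map_smul' := partialDeriv_smul i

theorem partialDeriv_zero (i : ι) : partialDeriv i (0 : Smooth U) = 0 := (partialDerivₗ i).map_zero

theorem partialDeriv_sum {κ : Type*} (i : ι) (s : Finset κ) (f : κ → Smooth U) :
    partialDeriv i (∑ k ∈ s, f k) = ∑ k ∈ s, partialDeriv i (f k) :=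
  map_sum (partialDerivₗ i) f s

/-- An iterated partial derivative is a value of the second Fréchet derivative, which is symmetric
for a smooth function. -/
theorem partialDeriv_comm (i j : ι) (f : Smooth U) :
    partialDeriv i (partialDeriv j f) = partialDeriv j (partialDeriv i f) := by
  refine Subtype.ext (funext fun x => ?_)
  have hf : ContDiffAt ℝ ∞ (extendZero U f.1) x := f.2.contDiffAt (U.isOpen.mem_nhds x.2)
  have hd : DifferentiableAt ℝ (fderiv ℝ (extendZero U f.1)) x :=
    (hf.fderiv_right (m := 1) (by norm_cast)).differentiableAt (by simp)
  have key : ∀ k l : ι, (partialDeriv k (partialDeriv l f)).1 x =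
      fderiv ℝ (fderiv ℝ (extendZero U f.1)) x (Pi.single k 1) (Pi.single l 1) := by
    intro k l
    have h : extendZero U (partialDeriv l f).1 =ᶠ[nhds (x : ι → ℝ)]
        fun y => fderiv ℝ (extendZero U f.1) y (Pi.single l 1) :=
      extendZero_congr (g := fun y => fderiv ℝ (extendZero U f.1) y (Pi.single l 1))
        (fun y => rfl) x
    rw [partialDeriv_apply, h.fderiv_eq, fderiv_clm_apply hd (differentiableAt_const _)]
    simp
  rw [key, key]
  exact (hf.isSymmSndFDerivAt (by simpa using WithTop.coe_le_coe.2 (le_top (a := (2 : ℕ∞))))) _ _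

end Smooth

namespace FieldContent

variable {X : FieldContent} {U : Opens X.Body}

/-! ### Derivatives of superfunctions -/

open Classical in
/-- The exponent of `Γ^A` if it is a formal variable, and `0` if it is a real coordinate. -/
def shift (A : X.Var) : X.Var →₀ ℕ := if IsReal A then 0 else Finsupp.single A 1

theorem shift_of_isReal {A : X.Var} (h : IsReal A) : shift A = 0 := if_pos h

theorem shift_of_not_isReal {A : X.Var} (h : ¬ IsReal A) : shift A = Finsupp.single A 1 := if_neg h

theorem parity_of_isReal {A : X.Var} (h : IsReal A) : parity A = 0 := by
  obtain ⟨α, rfl, h0, h1⟩ := h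
  simp [parity, fld, fieldParity, h0, h1]

theorem coeff_leftDeriv_of_isReal {A : X.Var} (h : IsReal A) (f : X.Fun U) (e : X.Var →₀ ℕ) :
    (leftDeriv A f).1 e = Smooth.partialDeriv ⟨A, h⟩ (f.1 e) := by
  by_cases he : Admissible e
  · rw [leftDeriv, coeff_ofCoeff _ he, dif_pos h]
  · rw [coeff_eq_zero _ he, coeff_eq_zero _ he, Smooth.partialDeriv_zero]

theorem coeff_leftDeriv {A : X.Var} (h : ¬ IsReal A) (f : X.Fun U) (e : X.Var →₀ ℕ) :
    (leftDeriv A f).1 e = (leftSign A e * ((e A : ℝ) + 1)) • f.1 (e + Finsupp.single A 1) := by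
  by_cases he : Admissible e
  · rw [leftDeriv, coeff_ofCoeff _ he, dif_neg h]
  · rw [coeff_eq_zero _ he, coeff_eq_zero f fun h => he h.left, smul_zero]

theorem coeff_rightDeriv_of_isReal {A : X.Var} (h : IsReal A) (f : X.Fun U) (e : X.Var →₀ ℕ) :
    (rightDeriv A f).1 e = Smooth.partialDeriv ⟨A, h⟩ (f.1 e) := by
  by_cases he : Admissible e
  · rw [rightDeriv, coeff_ofCoeff _ he, dif_pos h]
  · rw [coeff_eq_zero _ he, coeff_eq_zero _ he, Smooth.partialDeriv_zero]

theorem coeff_rightDeriv {A : X.Var} (h : ¬ IsReal A) (f : X.Fun U) (e : X.Var →₀ ℕ) :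
    (rightDeriv A f).1 e = (rightSign A e * ((e A : ℝ) + 1)) • f.1 (e + Finsupp.single A 1) := by
  by_cases he : Admissible e
  · rw [rightDeriv, coeff_ofCoeff _ he, dif_neg h]
  · rw [coeff_eq_zero _ he, coeff_eq_zero f fun h => he h.left, smul_zero]

/-- Differentiation removes the factor `shift A` from a monomial, and nothing when the variable is a
real coordinate. One statement thus covers both cases in the degree counts below. -/
theorem coeff_ne_of_leftDeriv {A : X.Var} {f : X.Fun U} {e : X.Var →₀ ℕ}
    (h : (leftDeriv A f).1 e ≠ 0) : f.1 (e + shift A) ≠ 0 := by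
  intro h0
  by_cases hA : IsReal A
  · rw [shift_of_isReal hA, add_zero] at h0
    exact h (by rw [coeff_leftDeriv_of_isReal hA, h0, Smooth.partialDeriv_zero])
  · rw [shift_of_not_isReal hA] at h0
    exact h (by rw [coeff_leftDeriv hA, h0, smul_zero])

theorem coeff_ne_of_rightDeriv {A : X.Var} {f : X.Fun U} {e : X.Var →₀ ℕ}
    (h : (rightDeriv A f).1 e ≠ 0) : f.1 (e + shift A) ≠ 0 := by
  intro h0
  by_cases hA : IsReal A
  · rw [shift_of_isReal hA, add_zero] at h0
    exact h (by rw [coeff_rightDeriv_of_isReal hA, h0, Smooth.partialDeriv_zero])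
  · rw [shift_of_not_isReal hA] at h0
    exact h (by rw [coeff_rightDeriv hA, h0, smul_zero])

/-- The left derivative as a linear map. -/
def leftDerivₗ (A : X.Var) : X.Fun U →ₗ[ℝ] X.Fun U where
  toFun := leftDeriv A
  map_add' f g := fun_ext fun e => by
    by_cases hA : IsReal A
    · simp only [coeff_add, coeff_leftDeriv_of_isReal hA, Smooth.partialDeriv_add]
    · simp only [coeff_add, coeff_leftDeriv hA, smul_add]
  map_smul' c f := fun_ext fun e => by
    by_cases hA : IsReal A
    · simp only [coeff_smul, coeff_leftDeriv_of_isReal hA, Smooth.partialDeriv_smul]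
      rfl
    · simp only [coeff_smul, coeff_leftDeriv hA, RingHom.id_apply]
      rw [smul_comm]

/-- The right derivative as a linear map. -/
def rightDerivₗ (A : X.Var) : X.Fun U →ₗ[ℝ] X.Fun U where
  toFun := rightDeriv A
  map_add' f g := fun_ext fun e => by
    by_cases hA : IsReal A
    · simp only [coeff_add, coeff_rightDeriv_of_isReal hA, Smooth.partialDeriv_add]
    · simp only [coeff_add, coeff_rightDeriv hA, smul_add]
  map_smul' c f := fun_ext fun e => by
    by_cases hA : IsReal A
    · simp only [coeff_smul, coeff_rightDeriv_of_isReal hA, Smooth.partialDeriv_smul]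
      rfl
    · simp only [coeff_smul, coeff_rightDeriv hA, RingHom.id_apply]
      rw [smul_comm]

theorem leftDeriv_add (A : X.Var) (f g : X.Fun U) :
    leftDeriv A (f + g) = leftDeriv A f + leftDeriv A g := (leftDerivₗ A).map_add f g

theorem leftDeriv_smul (A : X.Var) (c : ℝ) (f : X.Fun U) :
    leftDeriv A (c • f) = c • leftDeriv A f := (leftDerivₗ A).map_smul c f

theorem leftDeriv_sum {ι : Type*} (A : X.Var) (s : Finset ι) (f : ι → X.Fun U) :
    leftDeriv A (∑ i ∈ s, f i) = ∑ i ∈ s, leftDeriv A (f i) := map_sum (leftDerivₗ A) f s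

theorem rightDeriv_add (A : X.Var) (f g : X.Fun U) :
    rightDeriv A (f + g) = rightDeriv A f + rightDeriv A g := (rightDerivₗ A).map_add f g

theorem rightDeriv_smul (A : X.Var) (c : ℝ) (f : X.Fun U) :
    rightDeriv A (c • f) = c • rightDeriv A f := (rightDerivₗ A).map_smul c f

theorem rightDeriv_sub (A : X.Var) (f g : X.Fun U) :
    rightDeriv A (f - g) = rightDeriv A f - rightDeriv A g :=
  by rw [fun_sub_eq, fun_sub_eq, rightDeriv_add, rightDeriv_smul]

theorem rightDeriv_sum {ι : Type*} (A : X.Var) (s : Finset ι) (f : ι → X.Fun U) :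
    rightDeriv A (∑ i ∈ s, f i) = ∑ i ∈ s, rightDeriv A (f i) := map_sum (rightDerivₗ A) f s

theorem parityDegree_single (A : X.Var) : parityDegree (Finsupp.single A 1) = parity A := by
  classical
  rw [parityDegree, Finset.sum_eq_single A]
  · simp
  · intro B _ hB
    simp [Finsupp.single_eq_of_ne hB]
  · simp

theorem parityDegree_shift (A : X.Var) : parityDegree (shift A) = parity A := by
  by_cases hA : IsReal A
  · rw [shift_of_isReal hA, parity_of_isReal hA]; simp [parityDegree]
  · rw [shift_of_not_isReal hA, parityDegree_single]

theorem HasParity.leftDeriv {f : X.Fun U} {p : ZMod 2} (hf : HasParity f p) (A : X.Var) :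
    HasParity (leftDeriv A f) (p + parity A) := fun e he => by
  rw [← hf _ (coeff_ne_of_leftDeriv he), parityDegree_add, parityDegree_shift, add_assoc,
    CharTwo.add_self_eq_zero, add_zero]

theorem HasParity.mul {f g : X.Fun U} {p q : ZMod 2} (hf : HasParity f p) (hg : HasParity g q) :
    HasParity (f * g) (p + q) := fun e he => by
  obtain ⟨a, b, rfl, ha, hb⟩ := exists_of_coeff_mul_ne he
  rw [parityDegree_add, hf _ ha, hg _ hb]

/-- The pairing of a monomial with an odd variable occurring in it. -/
theorem pairing_single_swap {A : X.Var} {p : X.Var →₀ ℕ} (hp : Admissible p) (hA : parity A = 1)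
    (h : p A = 1) :
    pairing (Finsupp.single A 1) p + pairing p (Finsupp.single A 1) = parityDegree p + 1 := by
  classical
  obtain ⟨q, rfl⟩ : ∃ q, p = Finsupp.single A 1 + q :=
    ⟨p - Finsupp.single A 1, (add_tsub_cancel_of_le (Finsupp.single_le_iff.2 h.ge)).symm⟩
  have := pairing_swap hp
  rw [parityDegree_single, hA, one_mul] at this
  rw [pairing_add_left, pairing_add_right, parityDegree_add, parityDegree_single, hA, ← this]
  linear_combination (pairing (Finsupp.single A 1) (Finsupp.single A 1) - 1) *
    CharTwo.two_eq_zero (R := ZMod 2)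

/-! ### Coefficients of the derivative of a product -/

theorem sum_antidiagonal_add_single {M : Type*} [AddCommMonoid M] (A : X.Var) (e : X.Var →₀ ℕ)
    (G : (X.Var →₀ ℕ) → (X.Var →₀ ℕ) → M) (hG : ∀ p q, p A = 0 → G p q = 0) :
    ∑ p ∈ Finset.HasAntidiagonal.antidiagonal e, G (p.1 + Finsupp.single A 1) p.2 =
      ∑ p ∈ Finset.HasAntidiagonal.antidiagonal (e + Finsupp.single A 1 : X.Var →₀ ℕ),
        G p.1 p.2 := by
  classical
  rw [← Finset.sum_filter_of_ne (p := fun p : (X.Var →₀ ℕ) × (X.Var →₀ ℕ) => p.1 A ≠ 0)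
    (s := Finset.HasAntidiagonal.antidiagonal (e + Finsupp.single A 1))
    (fun p _ h h0 => h (hG _ _ h0))]
  refine Finset.sum_nbij' (fun p => (p.1 + Finsupp.single A 1, p.2))
    (fun p => (p.1 - Finsupp.single A 1, p.2)) ?_ ?_ ?_ ?_ ?_
  · intro p hp
    rw [Finset.HasAntidiagonal.mem_antidiagonal] at hp
    rw [Finset.mem_filter, Finset.HasAntidiagonal.mem_antidiagonal]
    exact ⟨by rw [← hp]; exact add_right_comm _ _ _, by simp⟩
  · intro p hp
    rw [Finset.mem_filter, Finset.HasAntidiagonal.mem_antidiagonal] at hp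
    rw [Finset.HasAntidiagonal.mem_antidiagonal]
    have hle : Finsupp.single A 1 ≤ p.1 := Finsupp.single_le_iff.2 (Nat.one_le_iff_ne_zero.2 hp.2)
    refine add_right_cancel (b := Finsupp.single A 1) ?_
    rw [← hp.1, add_right_comm, tsub_add_cancel_of_le hle]
  · intro p _
    simp
  · intro p hp
    rw [Finset.mem_filter] at hp
    have hle : Finsupp.single A 1 ≤ p.1 := Finsupp.single_le_iff.2 (Nat.one_le_iff_ne_zero.2 hp.2)
    simp [tsub_add_cancel_of_le hle]
  · intro p _
    rfl

theorem sum_antidiagonal_add_single' {M : Type*} [AddCommMonoid M] (A : X.Var) (e : X.Var →₀ ℕ)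
    (G : (X.Var →₀ ℕ) → (X.Var →₀ ℕ) → M) (hG : ∀ p q, q A = 0 → G p q = 0) :
    ∑ p ∈ Finset.HasAntidiagonal.antidiagonal e, G p.1 (p.2 + Finsupp.single A 1) =
      ∑ p ∈ Finset.HasAntidiagonal.antidiagonal (e + Finsupp.single A 1 : X.Var →₀ ℕ),
        G p.1 p.2 := by
  rw [Finsupp.sum_antidiagonal_swap e fun p q => G p (q + Finsupp.single A 1),
    Finsupp.sum_antidiagonal_swap (e + Finsupp.single A 1) G]
  exact sum_antidiagonal_add_single A e (fun p q => G q p) fun p q h => hG q p h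

theorem admissible_add_single {A : X.Var} (hA : ¬ IsReal A) {p : X.Var →₀ ℕ} (hp : Admissible p)
    (h : parity A = 1 → p A = 0) : Admissible (p + Finsupp.single A 1) := by
  classical
  intro B
  rw [Finsupp.add_apply]
  by_cases hB : A = B
  · subst hB
    exact ⟨fun h => absurd h hA, fun h1 => by rw [h h1]; simp⟩
  · rw [Finsupp.single_eq_of_ne (Ne.symm hB), add_zero]
    exact hp B

/-- The term of the product `f * g` that belongs to a pair of monomials. -/
def mulTerm (f g : X.Fun U) (p q : X.Var →₀ ℕ) : Smooth U := mulSign p q • (f.1 p * g.1 q)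

/-- Each term of `leftDeriv A f * g` is a term of `f * g` at the exponent raised by one `A`. Its
weight is the multiplicity of `A` in the first factor, which vanishes on the pairs that the
reindexing does not reach. -/
theorem mulTerm_leftDeriv_left {A : X.Var} (hA : ¬ IsReal A) (f g : X.Fun U) (p q : X.Var →₀ ℕ) :
    mulTerm (leftDeriv A f) g p q = leftSign A (p + q) •
      (((p + Finsupp.single A 1 : X.Var →₀ ℕ) A : ℕ) : ℝ) •
        mulTerm f g (p + Finsupp.single A 1) q := by
  rw [mulTerm, mulTerm, coeff_leftDeriv hA, Finsupp.add_apply, Finsupp.single_eq_same]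
  simp only [leftSign_eq, mulSign_eq, pairing_add_left, pairing_add_right, sgn_add, Nat.cast_add,
    smul_mul_assoc, smul_smul, Nat.cast_one]
  congr 1
  linear_combination (-sgn (pairing p q) * sgn (pairing (Finsupp.single A 1) p) * ((p A : ℝ) + 1)) *
    sgn_mul_self (pairing (Finsupp.single A 1) q)

/-- Here `r` is the sign prescribed by the Leibniz rule and `s` the discrepancy with the sign of
actually moving `A` past the monomial `p`. The discrepancy is 0 if `p` may be multiplied by `A`, and
1 if `A` is odd and already occurs in `p`. -/
theorem mulTerm_leftDeriv_right {A : X.Var} (hA : ¬ IsReal A) (f g : X.Fun U) (r s : ZMod 2)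
    (p q : X.Var →₀ ℕ) (hs : f.1 p ≠ 0 → g.1 (q + Finsupp.single A 1) ≠ 0 →
      pairing (Finsupp.single A 1) p + pairing p (Finsupp.single A 1) = r + s) :
    sgn r • mulTerm f (leftDeriv A g) p q = leftSign A (p + q) •
      (sgn s * (((q + Finsupp.single A 1 : X.Var →₀ ℕ) A : ℕ) : ℝ)) •
        mulTerm f g p (q + Finsupp.single A 1) := by
  rw [mulTerm, mulTerm, coeff_leftDeriv hA, Finsupp.add_apply, Finsupp.single_eq_same]
  by_cases h1 : f.1 p = 0
  · simp [h1]
  by_cases h2 : g.1 (q + Finsupp.single A 1) = 0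
  · simp [h2]
  have hs' := congrArg sgn (hs h1 h2)
  rw [sgn_add, sgn_add] at hs'
  simp only [leftSign_eq, mulSign_eq, pairing_add_right, sgn_add, Nat.cast_add,
    mul_smul_comm, smul_smul, Nat.cast_one]
  congr 1
  linear_combination (-sgn (pairing p q) * sgn (pairing (Finsupp.single A 1) q) *
      ((q A : ℝ) + 1) * sgn s) * hs' -
    (sgn (pairing p q) * sgn (pairing (Finsupp.single A 1) q) * ((q A : ℝ) + 1) * sgn r) *
      sgn_mul_self s

theorem coeff_mul_mulTerm (f g : X.Fun U) {e : X.Var →₀ ℕ} (he : Admissible e) :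
    (f * g).1 e = ∑ p ∈ Finset.HasAntidiagonal.antidiagonal e, mulTerm f g p.1 p.2 :=
  coeff_mul f g he

theorem coeff_leftDeriv_mul_left {A : X.Var} (hA : ¬ IsReal A) (f g : X.Fun U) {e : X.Var →₀ ℕ}
    (he : Admissible e) : (leftDeriv A f * g).1 e = leftSign A e •
      ∑ p ∈ Finset.HasAntidiagonal.antidiagonal (e + Finsupp.single A 1 : X.Var →₀ ℕ),
        (p.1 A : ℝ) • mulTerm f g p.1 p.2 := by
  rw [← sum_antidiagonal_add_single A e (fun p q => (p A : ℝ) • mulTerm f g p q)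
    fun p q h => by rw [h, Nat.cast_zero, zero_smul], coeff_mul_mulTerm _ _ he, Finset.smul_sum]
  refine Finset.sum_congr rfl fun p hp => ?_
  rw [mulTerm_leftDeriv_left hA, Finset.HasAntidiagonal.mem_antidiagonal.1 hp]

theorem coeff_leftDeriv_mul_right {A : X.Var} (hA : ¬ IsReal A) (f g : X.Fun U) (r s : ZMod 2)
    {e : X.Var →₀ ℕ} (he : Admissible e) (hs : ∀ p q, p + q = e → f.1 p ≠ 0 →
      g.1 (q + Finsupp.single A 1) ≠ 0 →
      pairing (Finsupp.single A 1) p + pairing p (Finsupp.single A 1) = r + s) :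
    sgn r • (f * leftDeriv A g).1 e = leftSign A e •
      ∑ p ∈ Finset.HasAntidiagonal.antidiagonal (e + Finsupp.single A 1 : X.Var →₀ ℕ),
        (sgn s * (p.2 A : ℝ)) • mulTerm f g p.1 p.2 := by
  rw [← sum_antidiagonal_add_single' A e (fun p q => (sgn s * (q A : ℝ)) • mulTerm f g p q)
    fun p q h => by rw [h, Nat.cast_zero, mul_zero, zero_smul], coeff_mul_mulTerm _ _ he,
    Finset.smul_sum, Finset.smul_sum]
  refine Finset.sum_congr rfl fun p hp => ?_
  rw [Finset.HasAntidiagonal.mem_antidiagonal] at hp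
  rw [mulTerm_leftDeriv_right hA f g r s p.1 p.2 (hs p.1 p.2 hp), hp]

/-- If an odd variable already occurs in `e`, the derivative of the product has no term at `e`, so
the two Leibniz terms have to cancel. After reindexing the total exponent of `A` is 2, hence 1 in
each factor; the weights agree and the extra sign `s = 1` makes them opposite. -/
theorem coeff_leftDeriv_mul_of_odd {A : X.Var} (hA : ¬ IsReal A) {f : X.Fun U} {r : ZMod 2}
    (hf : HasParity f r) (g : X.Fun U) {e : X.Var →₀ ℕ} (he : Admissible e)
    (hodd : parity A = 1) (heA : e A = 1) :
    (leftDeriv A f * g).1 e + sgn (parity A * r) • (f * leftDeriv A g).1 e = 0 := by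
  rw [coeff_leftDeriv_mul_left hA f g he, coeff_leftDeriv_mul_right hA f g (parity A * r) 1 he,
    ← smul_add, ← Finset.sum_add_distrib, Finset.sum_eq_zero, smul_zero]
  · intro p hp
    rw [Finset.HasAntidiagonal.mem_antidiagonal] at hp
    by_cases h1 : f.1 p.1 = 0
    · rw [mulTerm, h1, zero_mul, smul_zero, smul_zero, smul_zero, add_zero]
    by_cases h2 : g.1 p.2 = 0
    · rw [mulTerm, h2, mul_zero, smul_zero, smul_zero, smul_zero, add_zero]
    have e1 := ((admissible_of_coeff_ne _ h1) A).2 hodd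
    have e2 := ((admissible_of_coeff_ne _ h2) A).2 hodd
    have e3 := DFunLike.congr_fun hp A
    rw [Finsupp.add_apply, Finsupp.add_apply, Finsupp.single_eq_same, heA] at e3
    rw [show p.1 A = 1 by omega, show p.2 A = 1 by omega, ← add_smul, sgn_one, Nat.cast_one,
      mul_one, add_neg_cancel, zero_smul]
  · intro p q hpq h1 h2
    have hq : q A = 0 := by
      have := ((admissible_of_coeff_ne _ h2) A).2 hodd
      rw [Finsupp.add_apply, Finsupp.single_eq_same] at this
      omega
    have hp1 : p A = 1 := by rw [← heA, ← hpq, Finsupp.add_apply, hq, add_zero]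
    rw [pairing_single_swap (admissible_of_coeff_ne _ h1) hodd hp1, hf _ h1, hodd, one_mul]

/-- In the generic case the signs agree, `s = 0`, and the multiplicities of `A` in the two factors
add up to its multiplicity in `e + Finsupp.single A 1`, which is the factor produced by the
derivative. -/
theorem coeff_leftDeriv_mul_of_admissible {A : X.Var} (hA : ¬ IsReal A) {f : X.Fun U} {r : ZMod 2}
    (hf : HasParity f r) (g : X.Fun U) {e : X.Var →₀ ℕ} (he : Admissible e)
    (hadm : Admissible (e + Finsupp.single A 1)) :
    (leftDeriv A (f * g)).1 e =
      (leftDeriv A f * g).1 e + sgn (parity A * r) • (f * leftDeriv A g).1 e := by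
  rw [coeff_leftDeriv_mul_left hA f g he, coeff_leftDeriv_mul_right hA f g (parity A * r) 0 he,
    ← smul_add, ← Finset.sum_add_distrib, coeff_leftDeriv hA, mul_smul,
    coeff_mul_mulTerm _ _ hadm, Finset.smul_sum]
  · refine congrArg _ (Finset.sum_congr rfl fun p hp => ?_)
    rw [Finset.HasAntidiagonal.mem_antidiagonal] at hp
    rw [← add_smul, sgn_zero, one_mul, ← Nat.cast_add, ← Finsupp.add_apply, hp, Finsupp.add_apply,
      Finsupp.single_eq_same, Nat.cast_add, Nat.cast_one]
  · intro p q hpq h1 h2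
    have hle : Finsupp.single A 1 + p ≤ e + Finsupp.single A 1 := by
      rw [add_comm, ← hpq, add_right_comm]; exact le_self_add
    rw [pairing_swap (hadm.mono hle), hf _ h1, parityDegree_single, add_zero]

/-- The graded Leibniz rule. -/
theorem leftDeriv_mul (A : X.Var) {f : X.Fun U} {r : ZMod 2} (hf : HasParity f r) (g : X.Fun U) :
    leftDeriv A (f * g) = leftDeriv A f * g + sgn (parity A * r) • (f * leftDeriv A g) := by
  refine fun_ext fun e => ?_
  by_cases he : Admissible e
  swap
  · rw [coeff_eq_zero _ he, coeff_eq_zero _ he]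
  rw [coeff_add, coeff_smul]
  by_cases hA : IsReal A
  · rw [coeff_leftDeriv_of_isReal hA, coeff_mul _ _ he, coeff_mul _ _ he,
      coeff_mul _ _ he, parity_of_isReal hA, zero_mul, sgn_zero, one_smul,
      Smooth.partialDeriv_sum, ← Finset.sum_add_distrib]
    refine Finset.sum_congr rfl fun p _ => ?_
    rw [Smooth.partialDeriv_smul, Smooth.partialDeriv_mul, smul_add, coeff_leftDeriv_of_isReal hA,
      coeff_leftDeriv_of_isReal hA]
  by_cases hadm : Admissible (e + Finsupp.single A 1)
  · exact coeff_leftDeriv_mul_of_admissible hA hf g he hadm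
  -- With `e` admissible and `A` formal, the only obstruction to multiplying by `A` is an odd `A`
  -- that is already present.
  · have hodd : parity A = 1 ∧ e A ≠ 0 := by
      by_contra h
      refine hadm (admissible_add_single hA he fun h1 => ?_)
      by_contra h2; exact h ⟨h1, h2⟩
    have heA : e A = 1 := le_antisymm ((he A).2 hodd.1) (Nat.one_le_iff_ne_zero.2 hodd.2)
    rw [coeff_leftDeriv hA, coeff_eq_zero _ hadm, smul_zero,
      coeff_leftDeriv_mul_of_odd hA hf g he hodd.1 heA]

/-- Both sides pick out the coefficient at `e` times the two variables. Removing them in either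
order changes the sign by the exchange sign of the two variables, as computed by `pairing_swap`; for
an odd variable taken twice the coefficient is zero. -/
theorem leftDeriv_comm (A B : X.Var) (f : X.Fun U) :
    leftDeriv A (leftDeriv B f) = sgn (parity A * parity B) • leftDeriv B (leftDeriv A f) := by
  classical
  refine fun_ext fun e => ?_
  rw [coeff_smul]
  by_cases hA : IsReal A
  · rw [parity_of_isReal hA, zero_mul, sgn_zero, one_smul]
    by_cases hB : IsReal B
    · simp only [coeff_leftDeriv_of_isReal hA, coeff_leftDeriv_of_isReal hB]
      exact Smooth.partialDeriv_comm _ _ _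
    · simp only [coeff_leftDeriv_of_isReal hA, coeff_leftDeriv hB, Smooth.partialDeriv_smul]
  by_cases hB : IsReal B
  · rw [parity_of_isReal hB, mul_zero, sgn_zero, one_smul]
    simp only [coeff_leftDeriv_of_isReal hB, coeff_leftDeriv hA, Smooth.partialDeriv_smul]
  simp only [coeff_leftDeriv hA, coeff_leftDeriv hB, smul_smul]
  rw [add_right_comm e (Finsupp.single B 1)]
  by_cases h0 : f.1 (e + Finsupp.single A 1 + Finsupp.single B 1) = 0
  · rw [h0, smul_zero, smul_zero]
  congr 1
  have hadm := admissible_of_coeff_ne _ h0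
  rw [add_assoc] at hadm
  have hs := congrArg sgn (pairing_swap hadm.right)
  rw [parityDegree_single, parityDegree_single] at hs
  rw [← hs]
  simp only [leftSign_eq, pairing_add_right, sgn_add, Finsupp.add_apply]
  by_cases hAB : A = B
  · subst hAB
    linear_combination (-(sgn (pairing (Finsupp.single A 1) e)
      * sgn (pairing (Finsupp.single A 1) e)
      * sgn (pairing (Finsupp.single A 1) (Finsupp.single A 1))
      * ((e A : ℝ) + 1) * (((e A + (Finsupp.single A 1 : X.Var →₀ ℕ) A : ℕ) : ℝ) + 1))) *
      sgn_mul_self (pairing (Finsupp.single A 1) (Finsupp.single A 1))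
  · rw [Finsupp.single_eq_of_ne hAB, Finsupp.single_eq_of_ne (Ne.symm hAB), add_zero, add_zero]
    linear_combination (-(sgn (pairing (Finsupp.single A 1) e)
      * sgn (pairing (Finsupp.single B 1) e)
      * sgn (pairing (Finsupp.single B 1) (Finsupp.single A 1))
      * ((e A : ℝ) + 1) * ((e B : ℝ) + 1))) *
      sgn_mul_self (pairing (Finsupp.single A 1) (Finsupp.single B 1))

/-- Left and right derivatives of an even superfunction. -/
theorem rightDeriv_of_even (A : X.Var) {f : X.Fun U} (hf : HasParity f 0) :
    rightDeriv A f = sgn (parity A) • leftDeriv A f := by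
  classical
  refine fun_ext fun e => ?_
  rw [coeff_smul]
  by_cases hA : IsReal A
  · rw [parity_of_isReal hA, sgn_zero, one_smul, coeff_leftDeriv_of_isReal hA,
      coeff_rightDeriv_of_isReal hA]
  rw [coeff_leftDeriv hA, coeff_rightDeriv hA, smul_smul]
  by_cases h0 : f.1 (e + Finsupp.single A 1) = 0
  · rw [h0, smul_zero, smul_zero]
  congr 1
  -- As f is even, the remaining monomial `e` has the parity of `A`. Moving `A` across it costs the
  -- square of that parity, which over `ZMod 2` is the parity itself.
  have hs := pairing_swap (admissible_of_coeff_ne _ h0)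
  have hp := hf _ h0
  rw [parityDegree_add, parityDegree_single] at hp
  rw [parityDegree_single, CharTwo.add_eq_zero.1 hp, zmod_two_mul_self] at hs
  rw [← hs, rightSign_eq, leftSign_eq, sgn_add]
  linear_combination (-(sgn (pairing e (Finsupp.single A 1)) * ((e A : ℝ) + 1))) *
    sgn_mul_self (pairing (Finsupp.single A 1) e)

end FieldContent
end BV

namespace BV.FieldContent

variable {X : FieldContent} {U : Opens X.Body}

/-! ### The antibracket and the Jacobi identity -/

/-- The variable conjugate to `Γ^A`. -/
def dual (A : X.Var) : X.Var := Sum.elim (fun α => anti α) (fun α => fld α) (ofLex A)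

/-- The sign `(-1)^{ε(Φ^α)}` attached to `Φ^α` and to `Φ*_α`. -/
def conjSign (A : X.Var) : ℝ :=
  sgn (Sum.elim (fun α => fieldParity α) (fun α => fieldParity α) (ofLex A))

theorem var_cases {P : X.Var → Prop} (hf : ∀ α, P (fld α)) (ha : ∀ α, P (anti α)) (A : X.Var) :
    P A := by
  rcases h : ofLex A with α | α
  · have : A = fld α := h
    exact this ▸ hf α
  · have : A = anti α := h
    exact this ▸ ha α

theorem parity_fld (α : X.Field) : parity (fld α) = fieldParity α := rfl

theorem parity_anti (α : X.Field) : parity (anti α) = fieldParity α + 1 := rfl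

theorem dual_fld (α : X.Field) : dual (fld α) = anti α := rfl

theorem dual_anti (α : X.Field) : dual (anti α) = fld α := rfl

theorem conjSign_fld (α : X.Field) : conjSign (fld α) = sgn (fieldParity α) := rfl

theorem conjSign_anti (α : X.Field) : conjSign (anti α) = sgn (fieldParity α) := rfl

theorem dual_dual (A : X.Var) : dual (dual A) = A :=
  var_cases (P := fun A => dual (dual A) = A) (fun _ => rfl) (fun _ => rfl) A

theorem conjSign_dual (A : X.Var) : conjSign (dual A) = conjSign A :=
  var_cases (P := fun A => conjSign (dual A) = conjSign A) (fun _ => rfl) (fun _ => rfl) A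

theorem parity_dual (A : X.Var) : parity (dual A) = parity A + 1 :=
  var_cases (P := fun A => parity (dual A) = parity A + 1) (fun _ => rfl)
    (fun α => by
      rw [dual_anti, parity_fld, parity_anti, add_assoc, CharTwo.add_self_eq_zero, add_zero]) A

/-- Conjugation as a permutation of the variables. -/
def dualEquiv : X.Var ≃ X.Var := ⟨dual, dual, dual_dual, dual_dual⟩

theorem sum_var {M : Type*} [AddCommMonoid M] (F : X.Var → M) :
    ∑ A, F A = ∑ α : X.Field, (F (fld α) + F (anti α)) := by
  rw [Finset.sum_add_distrib, ← (toLex (α := X.Field ⊕ X.Field)).sum_comp, Fintype.sum_sum_type]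
  rfl

/-- For even f the right derivatives become left ones, and the two halves of the bracket merge into
one sum over all variables whose signs are invariant under conjugation. The Jacobi identity relies
on this symmetric form. -/
theorem antibracket_of_even {f : X.Fun U} (hf : HasParity f 0) (g : X.Fun U) :
    antibracket f g = ∑ A : X.Var, conjSign A • (leftDeriv A f * leftDeriv (dual A) g) := by
  rw [sum_var, antibracket]
  refine Finset.sum_congr rfl fun α _ => ?_
  rw [rightDeriv_of_even _ hf, rightDeriv_of_even _ hf, parity_fld, parity_anti, sgn_add, sgn_one]
  simp only [fun_smul_mul, conjSign_fld, conjSign_anti, dual_fld, dual_anti, fun_sub_eq,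
    fun_smul_smul, mul_neg, neg_mul, one_mul, mul_one, neg_neg]

theorem antibracket_comm {f g : X.Fun U} (hf : HasParity f 0) (hg : HasParity g 0) :
    antibracket f g = antibracket g f := by
  rw [antibracket_of_even hf, antibracket_of_even hg, ← dualEquiv.sum_comp]
  refine Finset.sum_congr rfl fun A _ => ?_
  change conjSign (dual A) • (leftDeriv (dual A) f * leftDeriv (dual (dual A)) g) = _
  rw [dual_dual, conjSign_dual, mul_comm_of_parity (hg.leftDeriv A) (hf.leftDeriv (dual A)),
    parity_dual]
  have : (0 + parity A) * (0 + (parity A + 1)) = 0 := by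
    generalize parity A = p; revert p; decide
  rw [this, sgn_zero, one_smul]

/-- The odd vector field `(f, ·)` of an even `f` is a graded derivation. -/
theorem antibracket_mul {f : X.Fun U} (hf : HasParity f 0) {g : X.Fun U} {p : ZMod 2}
    (hg : HasParity g p) (h : X.Fun U) :
    antibracket f (g * h) = antibracket f g * h + sgn p • (g * antibracket f h) := by
  rw [antibracket_of_even hf, antibracket_of_even hf, antibracket_of_even hf, fun_sum_mul,
    fun_mul_sum, fun_smul_sum, ← fun_sum_add]
  refine Finset.sum_congr rfl fun A _ => ?_
  rw [leftDeriv_mul _ hg]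
  simp only [fun_mul_add, fun_smul_add, fun_mul_smul, fun_smul_mul, ← fun_mul_assoc]
  rw [mul_comm_of_parity hg (hf.leftDeriv A)]
  simp only [fun_smul_mul, fun_smul_smul]
  rw [← sgn_add, mul_comm (sgn p)]
  congr 4
  rw [parity_dual, zero_add]
  linear_combination (p * parity A) * CharTwo.two_eq_zero (R := ZMod 2)

theorem antibracket_add_left (f f' g : X.Fun U) :
    antibracket (f + f') g = antibracket f g + antibracket f' g := by
  simp only [antibracket, fun_sub_eq, rightDeriv_add, fun_add_mul, fun_smul_add, fun_sum_add]
  abel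

theorem antibracket_add_right (f g g' : X.Fun U) :
    antibracket f (g + g') = antibracket f g + antibracket f g' := by
  simp only [antibracket, fun_sub_eq, leftDeriv_add, fun_mul_add, fun_smul_add, fun_sum_add]
  abel

theorem antibracket_smul_right (c : ℝ) (f g : X.Fun U) :
    antibracket f (c • g) = c • antibracket f g := by
  simp only [antibracket, fun_sub_eq, leftDeriv_smul, fun_mul_smul, fun_smul_add, fun_smul_sum,
    fun_smul_smul, mul_comm]

/-- The antibracket with a fixed first entry as a linear map. -/
def antibracketₗ (f : X.Fun U) : X.Fun U →ₗ[ℝ] X.Fun U where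
  toFun := antibracket f
  map_add' := antibracket_add_right f
  map_smul' c := antibracket_smul_right c f

theorem antibracket_sum_right {ι : Type*} (f : X.Fun U) (s : Finset ι) (g : ι → X.Fun U) :
    antibracket f (∑ i ∈ s, g i) = ∑ i ∈ s, antibracket f (g i) :=
  map_sum (antibracketₗ f) g s

theorem HasParity.antibracket {f g : X.Fun U} {p : ZMod 2} (hf : HasParity f 0)
    (hg : HasParity g p) : HasParity (antibracket f g) (p + 1) := by
  rw [antibracket_of_even hf]
  intro e he
  rw [coeff_sum] at he
  obtain ⟨A, _, hA⟩ := Finset.exists_ne_zero_of_sum_ne_zero he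
  have h : (FieldContent.leftDeriv A f * FieldContent.leftDeriv (dual A) g).1 e ≠ 0 := fun h =>
    hA (by rw [coeff_smul, h, smul_zero])
  rw [((hf.leftDeriv A).mul (hg.leftDeriv (dual A))) e h, parity_dual]
  linear_combination parity A * CharTwo.two_eq_zero (R := ZMod 2)

/-- The triple products whose sum is the Jacobi expression of an even superfunction. -/
def jacobiTerm (f : X.Fun U) (A B : X.Var) : X.Fun U :=
  (conjSign A * conjSign B) • (leftDeriv B f * (leftDeriv (dual B) (leftDeriv A f) *
    leftDeriv (dual A) f))

/-- The substitution of (A*, B*) for (B, A) produces the same three factors in reverse order.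
Reordering them and exchanging the two inner derivatives gives total sign -1 for all parities. -/
theorem jacobiTerm_dual {f : X.Fun U} (hf : HasParity f 0) (A B : X.Var) :
    jacobiTerm f (dual B) (dual A) = (-1 : ℝ) • jacobiTerm f A B := by
  have h1 := hf.leftDeriv B
  have h2 := (hf.leftDeriv A).leftDeriv (dual B)
  have h3 := hf.leftDeriv (dual A)
  rw [jacobiTerm, jacobiTerm, dual_dual, dual_dual, conjSign_dual, conjSign_dual,
    leftDeriv_comm A (dual B)]
  have e1 : leftDeriv (dual A) f * (leftDeriv (dual B) (leftDeriv A f) * leftDeriv B f) =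
      sgn ((0 + parity B) * (0 + parity A + parity (dual B)) +
        ((0 + parity B) + (0 + parity A + parity (dual B))) * (0 + parity (dual A))) •
      (leftDeriv B f * (leftDeriv (dual B) (leftDeriv A f) * leftDeriv (dual A) f)) := by
    rw [mul_comm_of_parity h1 h2, fun_mul_smul, mul_comm_of_parity (h1.mul h2) h3, fun_smul_smul,
      ← sgn_add, fun_mul_assoc]
  simp only [fun_smul_mul, fun_mul_smul, fun_smul_smul, e1]
  congr 1
  rw [mul_assoc, ← sgn_add, parity_dual, parity_dual]
  have : parity A * (parity B + 1) + ((0 + parity B) * (0 + parity A + (parity B + 1)) +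
      (0 + parity B + (0 + parity A + (parity B + 1))) * (0 + (parity A + 1))) = 1 := by
    generalize parity A = p
    generalize parity B = q
    revert p q; decide
  rw [this, sgn_one]
  ring

theorem antibracket_leftDeriv_mul {f : X.Fun U} (hf : HasParity f 0) (A : X.Var) (h : X.Fun U) :
    conjSign A • (antibracket f (leftDeriv A f) * h) = ∑ B, (conjSign A * conjSign B) •
      (leftDeriv B f * (leftDeriv (dual B) (leftDeriv A f) * h)) := by
  rw [antibracket_of_even hf, fun_sum_mul]
  simp only [fun_smul_sum, fun_smul_mul, fun_mul_assoc, fun_smul_smul]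

/-- The derivation (f, ·) hits either factor. Moving the result of the second hit to the front turns
it into the first term for the conjugate variable, with trivial total sign. -/
theorem antibracket_conj_term {f : X.Fun U} (hf : HasParity f 0) (A : X.Var) :
    antibracket f (conjSign A • (leftDeriv A f * leftDeriv (dual A) f)) =
      ∑ B, jacobiTerm f A B + ∑ B, jacobiTerm f (dual A) B := by
  have hA := hf.leftDeriv A
  have h0 : 0 + parity A + (0 + parity (dual A) + 1) * (0 + parity A) = 0 := by
    rw [parity_dual]; generalize parity A = p; revert p; decide
  have h1 : sgn (0 + parity A) • (leftDeriv A f * antibracket f (leftDeriv (dual A) f)) =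
      antibracket f (leftDeriv (dual A) f) * leftDeriv A f := by
    rw [mul_comm_of_parity (hf.antibracket (hf.leftDeriv (dual A))) hA]
    simp only [fun_smul_smul]
    rw [← sgn_add, h0, sgn_zero, fun_one_smul]
  have h2 := antibracket_leftDeriv_mul hf A (leftDeriv (dual A) f)
  have h3 := antibracket_leftDeriv_mul hf (dual A) (leftDeriv A f)
  rw [antibracket_smul_right, antibracket_mul hf hA, h1]
  simp only [fun_smul_add, jacobiTerm, dual_dual]
  rw [h2, ← h3, conjSign_dual]

theorem antibracket_antibracket_self_eq {f : X.Fun U} (hf : HasParity f 0) :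
    antibracket f (antibracket f f) = (2 : ℝ) • ∑ A, ∑ B, jacobiTerm f A B := by
  have h4 : ∑ A, ∑ B, jacobiTerm f (dual A) B = ∑ A, ∑ B, jacobiTerm f A B :=
    dualEquiv.sum_comp fun A => ∑ B, jacobiTerm f A B
  have h5 : antibracket f (antibracket f f) =
      ∑ A, (∑ B, jacobiTerm f A B + ∑ B, jacobiTerm f (dual A) B) := by
    rw [antibracket_of_even hf f, antibracket_sum_right]
    exact Finset.sum_congr rfl fun A _ => antibracket_conj_term hf A
  rw [h5, fun_sum_add, h4, show (2 : ℝ) = 1 + 1 by norm_num, fun_add_smul, fun_one_smul]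

/-- The Jacobi identity for an even superfunction. -/
theorem antibracket_antibracket_self {f : X.Fun U} (hf : HasParity f 0) :
    antibracket f (antibracket f f) = 0 := by
  -- The involution (A, B) ↦ (B*, A*) permutes the terms of the double sum and reverses their signs,
  -- so the sum is its own negative.
  have hneg : ∑ A, ∑ B, jacobiTerm f A B = (-1 : ℝ) • ∑ A, ∑ B, jacobiTerm f A B := by
    have h1 : ∑ A, ∑ B, jacobiTerm f (dual B) (dual A) = ∑ A, ∑ B, jacobiTerm f A B := by
      rw [Finset.sum_comm]
      refine (dualEquiv.sum_comp fun A => ∑ B, jacobiTerm f A (dual B)).trans ?_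
      exact Finset.sum_congr rfl fun A _ => dualEquiv.sum_comp fun B => jacobiTerm f A B
    refine h1.symm.trans ?_
    simp only [fun_smul_sum]
    refine Finset.sum_congr rfl fun A _ => Finset.sum_congr rfl fun B _ => ?_
    exact jacobiTerm_dual hf A B
  rw [antibracket_antibracket_self_eq hf]
  refine fun_ext fun e => ?_
  have h := congrArg (fun g : X.Fun U => g.1 e) hneg
  simp only [coeff_smul, neg_one_smul] at h
  have h2 := add_eq_zero_iff_eq_neg.2 h
  rw [coeff_smul, coeff_zero, two_smul, h2]

end BV.FieldContent

namespace BV.FieldContent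

variable {X : FieldContent} {U : Opens X.Body}

/-! ### Degrees -/

theorem fld_injective : Function.Injective (fld (X := X)) := fun _ _ h => Sum.inl_injective h

theorem anti_injective : Function.Injective (anti (X := X)) := fun _ _ h => Sum.inr_injective h

theorem anti_ne_fld (α β : X.Field) : anti α ≠ fld β := fun h => Sum.inr_ne_inl h

theorem not_isReal_anti (α : X.Field) : ¬ IsReal (anti α) := fun ⟨_, h, _⟩ => anti_ne_fld _ _ h

theorem not_isReal_fld {α : X.Field} (h : level α ≠ 0) : ¬ IsReal (fld α) := by
  rintro ⟨β, hβ, h0, _⟩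
  exact h (fld_injective hβ ▸ h0)

theorem isGhost_fld {α : X.Field} : IsGhost (fld α) ↔ level α ≠ 0 :=
  ⟨fun ⟨_, h, h0⟩ => fld_injective h ▸ h0, fun h => ⟨α, rfl, h⟩⟩

theorem not_isGhost_anti (α : X.Field) : ¬ IsGhost (anti α) := fun ⟨_, h, _⟩ => anti_ne_fld _ _ h

theorem isAntifield_anti (α : X.Field) : IsAntifield (anti α) := ⟨α, rfl⟩

theorem not_isAntifield_fld (α : X.Field) : ¬ IsAntifield (fld α) :=
  fun ⟨_, h⟩ => anti_ne_fld _ _ h.symm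

theorem ghost_fld (α : X.Field) : ghost (fld α) = ((level α : ℕ) : ℤ) := rfl

theorem ghost_anti (α : X.Field) : ghost (anti α) = -((level α : ℕ) : ℤ) - 1 := rfl

theorem antifieldNumber_fld (α : X.Field) : antifieldNumber (fld α) = 0 := rfl

theorem antifieldNumber_anti (α : X.Field) : antifieldNumber (anti α) = (level α : ℕ) + 1 := rfl

theorem numGhosts_add (a b : X.Var →₀ ℕ) : numGhosts (a + b) = numGhosts a + numGhosts b := by
  simp only [numGhosts, ← Finset.sum_add_distrib, Finsupp.add_apply]
  exact Finset.sum_congr rfl fun A _ => by split_ifs <;> rfl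

theorem numAntifields_add (a b : X.Var →₀ ℕ) :
    numAntifields (a + b) = numAntifields a + numAntifields b := by
  simp only [numAntifields, ← Finset.sum_add_distrib, Finsupp.add_apply]
  exact Finset.sum_congr rfl fun A _ => by split_ifs <;> rfl

theorem afnDegree_add (a b : X.Var →₀ ℕ) : afnDegree (a + b) = afnDegree a + afnDegree b := by
  simp only [afnDegree, ← Finset.sum_add_distrib, Finsupp.add_apply, add_mul]

theorem ghDegree_add (a b : X.Var →₀ ℕ) : ghDegree (a + b) = ghDegree a + ghDegree b := by
  simp only [ghDegree, ← Finset.sum_add_distrib, Finsupp.add_apply, Nat.cast_add, add_mul]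

theorem numGhosts_zero : numGhosts (0 : X.Var →₀ ℕ) = 0 := by simp [numGhosts]

theorem numAntifields_zero : numAntifields (0 : X.Var →₀ ℕ) = 0 := by simp [numAntifields]

open Classical in
theorem sum_single_mul {R : Type*} [Semiring R] (A : X.Var) (w : X.Var → R) :
    ∑ B, (((Finsupp.single A 1 : X.Var →₀ ℕ) B : ℕ) : R) * w B = w A := by
  rw [Finset.sum_eq_single A]
  · simp
  · intro B _ hB
    simp [Finsupp.single_eq_of_ne hB]
  · simp

open Classical in
theorem numGhosts_single (A : X.Var) :
    numGhosts (Finsupp.single A 1) = if IsGhost A then 1 else 0 := by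
  rw [← sum_single_mul A fun B => if IsGhost B then 1 else 0, numGhosts]
  simp

open Classical in
theorem numAntifields_single (A : X.Var) :
    numAntifields (Finsupp.single A 1) = if IsAntifield A then 1 else 0 := by
  rw [← sum_single_mul A fun B => if IsAntifield B then 1 else 0, numAntifields]
  simp

theorem afnDegree_single (A : X.Var) : afnDegree (Finsupp.single A 1) = antifieldNumber A := by
  rw [← sum_single_mul A antifieldNumber, afnDegree]
  simp

theorem ghDegree_single (A : X.Var) : ghDegree (Finsupp.single A 1) = ghost A :=
  sum_single_mul A ghost

open Classical in
theorem numGhosts_shift (A : X.Var) : numGhosts (shift A) = if IsGhost A then 1 else 0 := by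
  by_cases hA : IsReal A
  · obtain ⟨α, rfl, h0, _⟩ := id hA
    rw [shift_of_isReal hA, numGhosts_zero, if_neg fun h => isGhost_fld.1 h h0]
  · rw [shift_of_not_isReal hA, numGhosts_single]

theorem numGhosts_shift_anti (α : X.Field) : numGhosts (shift (anti α)) = 0 := by
  classical
  rw [numGhosts_shift, if_neg (not_isGhost_anti α)]

theorem numGhosts_shift_fld_le (α : X.Field) : numGhosts (shift (fld α)) ≤ 1 := by
  classical
  rw [numGhosts_shift]; split_ifs <;> simp

theorem numGhosts_shift_ghost {α : X.Field} (h : level α ≠ 0) : numGhosts (shift (fld α)) = 1 := by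
  classical
  rw [numGhosts_shift, if_pos (isGhost_fld.2 h)]

theorem numGhosts_shift_original {α : X.Field} (h : level α = 0) :
    numGhosts (shift (fld α)) = 0 := by
  classical
  rw [numGhosts_shift, if_neg fun h' => isGhost_fld.1 h' h]

theorem numAntifields_shift_fld (α : X.Field) : numAntifields (shift (fld α)) = 0 := by
  classical
  by_cases hA : IsReal (fld α)
  · rw [shift_of_isReal hA, numAntifields_zero]
  · rw [shift_of_not_isReal hA, numAntifields_single, if_neg (not_isAntifield_fld α)]

theorem numAntifields_shift_anti (α : X.Field) : numAntifields (shift (anti α)) = 1 := by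
  classical
  rw [shift_of_not_isReal (not_isReal_anti α), numAntifields_single, if_pos (isAntifield_anti α)]

theorem afnDegree_shift_fld (α : X.Field) : afnDegree (shift (fld α)) = 0 := by
  by_cases hA : IsReal (fld α)
  · rw [shift_of_isReal hA]; simp [afnDegree]
  · rw [shift_of_not_isReal hA, afnDegree_single]; rfl

theorem afnDegree_shift_anti (α : X.Field) : afnDegree (shift (anti α)) = (level α : ℕ) + 1 := by
  rw [shift_of_not_isReal (not_isReal_anti α), afnDegree_single]; rfl

theorem ghDegree_shift_fld (α : X.Field) : ghDegree (shift (fld α)) = ((level α : ℕ) : ℤ) := by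
  by_cases hA : IsReal (fld α)
  · obtain ⟨β, hβ, h0, _⟩ := id hA
    rw [shift_of_isReal hA, fld_injective hβ, h0]; simp [ghDegree]
  · rw [shift_of_not_isReal hA, ghDegree_single]; rfl

theorem ghDegree_shift_anti (α : X.Field) :
    ghDegree (shift (anti α)) = -((level α : ℕ) : ℤ) - 1 := by
  rw [shift_of_not_isReal (not_isReal_anti α), ghDegree_single]; rfl

/-- The pure ghost number is at least the number of ghosts. -/
theorem numGhosts_le (e : X.Var →₀ ℕ) : (numGhosts e : ℤ) ≤ ghDegree e + afnDegree e := by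
  classical
  rw [numGhosts, ghDegree, afnDegree, Nat.cast_sum, Nat.cast_sum, ← Finset.sum_add_distrib]
  refine Finset.sum_le_sum fun A _ => ?_
  -- Ghost and antifield number cancel on an antifield; on a field their sum is its level, which is
  -- at least 1 for a ghost.
  refine var_cases (P := fun A =>
    ((if IsGhost A then e A else 0 : ℕ) : ℤ) ≤ (e A : ℤ) * ghost A +
      ((e A * antifieldNumber A : ℕ) : ℤ)) (fun α => ?_) (fun α => ?_) A
  · rw [ghost_fld, antifieldNumber_fld, mul_zero, Nat.cast_zero, add_zero]
    split_ifs with h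
    · have := Nat.one_le_iff_ne_zero.2 fun h0 => isGhost_fld.1 h (Fin.ext h0)
      nlinarith
    · positivity
  · rw [ghost_anti, antifieldNumber_anti, if_neg (not_isGhost_anti α)]
    push_cast; ring_nf; rfl

/-- The pure ghost number vanishes in the absence of ghosts. -/
theorem ghDegree_of_numGhosts_eq_zero {e : X.Var →₀ ℕ} (h : numGhosts e = 0) :
    ghDegree e = -(afnDegree e : ℤ) := by
  classical
  rw [eq_neg_iff_add_eq_zero, ghDegree, afnDegree, Nat.cast_sum, ← Finset.sum_add_distrib]
  refine Finset.sum_eq_zero fun A _ => ?_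
  have hA := (Finset.sum_eq_zero_iff.1 h) A (Finset.mem_univ A)
  revert hA
  refine var_cases (P := fun A =>
    (if IsGhost A then e A else 0) = 0 → (e A : ℤ) * ghost A + ((e A * antifieldNumber A : ℕ) : ℤ) = 0)
    (fun α => ?_) (fun α => ?_) A
  · intro hA
    rw [ghost_fld, antifieldNumber_fld, mul_zero, Nat.cast_zero, add_zero]
    by_cases h0 : level α = 0
    · simp [h0]
    · rw [if_pos (isGhost_fld.2 h0)] at hA
      rw [hA, Nat.cast_zero, zero_mul]
  · intro _
    rw [ghost_anti, antifieldNumber_anti]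
    push_cast; ring

theorem afnDegree_of_numAntifields_eq_zero {e : X.Var →₀ ℕ} (h : numAntifields e = 0) :
    afnDegree e = 0 := by
  classical
  refine Finset.sum_eq_zero fun A _ => ?_
  have hA := (Finset.sum_eq_zero_iff.1 h) A (Finset.mem_univ A)
  revert hA
  refine var_cases (P := fun A =>
    (if IsAntifield A then e A else 0) = 0 → e A * antifieldNumber A = 0)
    (fun α => ?_) (fun α => ?_) A
  · intro _
    rw [antifieldNumber_fld, mul_zero]
  · intro hA
    rw [if_pos (isAntifield_anti α)] at hA
    rw [hA, zero_mul]

/-! ### Superfunctions with prescribed monomials -/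

variable (U) in
/-- The superfunctions all of whose monomials satisfy `P`. -/
def supported (P : (X.Var →₀ ℕ) → Prop) : Submodule ℝ (X.Fun U) where
  carrier := {f | ∀ e, f.1 e ≠ 0 → P e}
  add_mem' {f g} hf hg e he := by
    by_cases h : f.1 e = 0
    · exact hg e fun h' => he (by rw [coeff_add, h, h', add_zero])
    · exact hf e h
  zero_mem' e he := absurd rfl he
  smul_mem' c f hf e he := hf e fun h => he (by rw [coeff_smul, h, smul_zero])

theorem supported_mono {P Q : (X.Var →₀ ℕ) → Prop} (h : ∀ e, P e → Q e) {f : X.Fun U}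
    (hf : f ∈ supported U P) : f ∈ supported U Q := fun e he => h e (hf e he)

theorem supported_sub {P : (X.Var →₀ ℕ) → Prop} {f g : X.Fun U} (hf : f ∈ supported U P)
    (hg : g ∈ supported U P) : f - g ∈ supported U P := by
  rw [fun_sub_eq]
  exact (supported U P).add_mem hf ((supported U P).smul_mem _ hg)

theorem supported_mul {P Q R : (X.Var →₀ ℕ) → Prop} {f g : X.Fun U} (hf : f ∈ supported U P)
    (hg : g ∈ supported U Q) (h : ∀ a b, P a → Q b → R (a + b)) : f * g ∈ supported U R := by
  intro e he
  obtain ⟨a, b, rfl, ha, hb⟩ := exists_of_coeff_mul_ne he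
  exact h a b (hf a ha) (hg b hb)

theorem supported_leftDeriv {P : (X.Var →₀ ℕ) → Prop} {f : X.Fun U} (hf : f ∈ supported U P)
    (A : X.Var) : leftDeriv A f ∈ supported U fun e => P (e + shift A) :=
  fun _ he => hf _ (coeff_ne_of_leftDeriv he)

theorem supported_rightDeriv {P : (X.Var →₀ ℕ) → Prop} {f : X.Fun U} (hf : f ∈ supported U P)
    (A : X.Var) : rightDeriv A f ∈ supported U fun e => P (e + shift A) :=
  fun _ he => hf _ (coeff_ne_of_rightDeriv he)

theorem eq_zero_of_supported {P Q : (X.Var →₀ ℕ) → Prop} {f : X.Fun U} (hf : f ∈ supported U P)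
    (hg : f ∈ supported U Q) (h : ∀ e, P e → ¬ Q e) : f = 0 :=
  fun_ext fun e => by_contra fun he => h e (hf e he) (hg e he)

open Classical in
/-- The part of `f` consisting of the monomials that satisfy `P`. -/
def restrict (P : (X.Var →₀ ℕ) → Prop) (f : X.Fun U) : X.Fun U :=
  ⟨fun e => if P e then f.1 e else 0, fun e he => by
    change (if P e then f.1 e else 0) = 0
    rw [coeff_eq_zero f he, ite_self]⟩

theorem restrict_supported (P : (X.Var →₀ ℕ) → Prop) (f : X.Fun U) :
    restrict P f ∈ supported U P := fun e he => by
  by_contra h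
  exact he (if_neg h)

open Classical in
theorem restrict_mem {P Q : (X.Var →₀ ℕ) → Prop} {f : X.Fun U} (hf : f ∈ supported U Q) :
    restrict P f ∈ supported U Q := fun e he => by
  refine hf e fun h => he ?_
  change (if P e then f.1 e else 0) = 0
  rw [h, ite_self]

open Classical in
theorem sub_restrict_supported {P : (X.Var →₀ ℕ) → Prop} {f : X.Fun U} :
    f - restrict P f ∈ supported U fun e => ¬ P e := fun e he hP => by
  refine he ?_
  rw [coeff_sub]
  change f.1 e - (if P e then f.1 e else 0) = 0
  rw [if_pos hP, sub_self]

theorem sub_restrict_mem {P Q : (X.Var →₀ ℕ) → Prop} {f : X.Fun U} (hf : f ∈ supported U Q) :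
    f - restrict P f ∈ supported U Q := supported_sub hf (restrict_mem hf)

theorem supported_and {P Q : (X.Var →₀ ℕ) → Prop} {f : X.Fun U} (hf : f ∈ supported U P)
    (hg : f ∈ supported U Q) : f ∈ supported U fun e => P e ∧ Q e :=
  fun e he => ⟨hf e he, hg e he⟩

/-- The monomials of an antibracket. -/
theorem antibracket_mem {P Q R : (X.Var →₀ ℕ) → Prop} {f g : X.Fun U} (hf : f ∈ supported U P)
    (hg : g ∈ supported U Q)
    (h₁ : ∀ α a b, P (a + shift (fld α)) → Q (b + shift (anti α)) → R (a + b))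
    (h₂ : ∀ α a b, P (a + shift (anti α)) → Q (b + shift (fld α)) → R (a + b)) :
    antibracket f g ∈ supported U R :=
  Submodule.sum_mem _ fun α _ => supported_sub
    (supported_mul (supported_rightDeriv hf _) (supported_leftDeriv hg _) (h₁ α))
    (supported_mul (supported_rightDeriv hf _) (supported_leftDeriv hg _) (h₂ α))

/-! ### Generators -/

/-- The constant superfunction `1`. -/
def oneFun : X.Fun U := by
  classical exact Fun.ofCoeff fun e => if e = 0 then 1 else 0

theorem admissible_zero : Admissible (0 : X.Var →₀ ℕ) := fun A => by simp

theorem pairing_zero_left (e : X.Var →₀ ℕ) : pairing 0 e = 0 := by simp [pairing]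

theorem pairing_zero_right (e : X.Var →₀ ℕ) : pairing e 0 = 0 := by simp [pairing]

theorem mul_oneFun (f : X.Fun U) : f * oneFun = f := by
  classical
  refine fun_ext fun e => ?_
  by_cases he : Admissible e
  swap
  · rw [coeff_eq_zero _ he, coeff_eq_zero _ he]
  rw [coeff_mul _ _ he, Finset.sum_eq_single (e, 0)]
  · rw [mulSign_eq, pairing_zero_right, sgn_zero, oneFun, coeff_ofCoeff _ admissible_zero,
      if_pos rfl, mul_one, one_smul]
  · intro p hp hne
    rw [Finset.HasAntidiagonal.mem_antidiagonal] at hp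
    have h2 : p.2 ≠ 0 := fun h => hne (Prod.ext (by rw [← hp, h, add_zero]) h)
    have h0 : (oneFun : X.Fun U).1 p.2 = 0 := by
      have hadm : Admissible p.2 := by rw [← hp] at he; exact he.right
      rw [oneFun, coeff_ofCoeff _ hadm, if_neg h2]
    rw [h0, mul_zero, smul_zero]
  · intro h
    exact absurd (Finset.HasAntidiagonal.mem_antidiagonal.2 (add_zero e)) h

theorem admissible_single {A : X.Var} (hA : ¬ IsReal A) : Admissible (Finsupp.single A 1) := by
  have := admissible_add_single hA admissible_zero fun _ => rfl
  rwa [zero_add] at this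

theorem coeff_gen_self {A : X.Var} (hA : ¬ IsReal A) :
    (gen A : X.Fun U).1 (Finsupp.single A 1) = 1 := by
  rw [gen, coeff_ofCoeff _ (admissible_single hA), if_pos rfl]

theorem gen_supported (A : X.Var) :
    (gen A : X.Fun U) ∈ supported U fun e => e = Finsupp.single A 1 := by
  intro e he
  by_contra h
  refine he ?_
  rw [gen, coeff_ofCoeff _ (admissible_of_coeff_ne _ he), if_neg h]

theorem coeff_mul_gen (f : X.Fun U) {A : X.Var} (hA : ¬ IsReal A) {e : X.Var →₀ ℕ}
    (he : Admissible (e + Finsupp.single A 1)) :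
    (f * gen A).1 (e + Finsupp.single A 1) = mulSign e (Finsupp.single A 1) • f.1 e := by
  rw [coeff_mul _ _ he, Finset.sum_eq_single (e, Finsupp.single A 1)]
  · rw [coeff_gen_self hA, mul_one]
  · intro p hp hne
    rw [Finset.HasAntidiagonal.mem_antidiagonal] at hp
    have h0 : (gen A : X.Fun U).1 p.2 = 0 := by
      by_contra h
      have h2 := gen_supported A _ h
      rw [h2] at hp
      exact hne (Prod.ext (add_right_cancel hp) h2)
    rw [h0, mul_zero, smul_zero]
  · intro h
    refine absurd ?_ h
    rw [Finset.HasAntidiagonal.mem_antidiagonal]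

/-- The variable already stands at the right end of the product and does not occur in f, so the
derivative undoes the multiplication: the signs of both operations coincide and square to 1. -/
theorem rightDeriv_mul_gen {f : X.Fun U} {A : X.Var} (hA : ¬ IsReal A)
    (hf : f ∈ supported U fun e => e A = 0) : rightDeriv A (f * gen A) = f := by
  refine fun_ext fun e => ?_
  rw [coeff_rightDeriv hA]
  by_cases h0 : f.1 e = 0
  · by_cases hadm : Admissible (e + Finsupp.single A 1)
    · rw [coeff_mul_gen f hA hadm, h0, smul_zero, smul_zero]
    · rw [coeff_eq_zero _ hadm, h0, smul_zero]
  · rw [coeff_mul_gen f hA (admissible_add_single hA (admissible_of_coeff_ne _ h0)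
      fun _ => hf e h0),
      smul_smul, hf e h0, rightSign_eq, mulSign_eq, Nat.cast_zero, zero_add, mul_one, sgn_mul_self,
      one_smul]

theorem leftDeriv_gen_self {A : X.Var} (hA : ¬ IsReal A) :
    leftDeriv A (gen A : X.Fun U) = oneFun := by
  classical
  refine fun_ext fun e => ?_
  by_cases he : Admissible e
  swap
  · rw [coeff_eq_zero _ he, coeff_eq_zero _ he]
  rw [coeff_leftDeriv hA, oneFun, coeff_ofCoeff _ he]
  split_ifs with h
  · rw [h, zero_add, coeff_gen_self hA, leftSign_eq, pairing_zero_right, sgn_zero,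
      Finsupp.zero_apply, Nat.cast_zero, zero_add, mul_one, one_smul]
  · have h0 : (gen A : X.Fun U).1 (e + Finsupp.single A 1) = 0 := by
      by_contra h1
      have := gen_supported A _ h1
      exact h (by simpa using this)
    rw [h0, smul_zero]

end BV.FieldContent

namespace BV.FieldContent

variable {X : FieldContent} {U : Opens X.Body}

/-! ### The Koszul–Tate operator -/

theorem level_mkField (k : Fin (X.L + 2)) (a : Fin (X.m k)) : level (mkField k a) = k := rfl

theorem field_cases {P : X.Field → Prop} (h0 : ∀ i : Fin (X.m 0), P (mkField 0 i))
    (h1 : ∀ (s : Fin (X.L + 1)) (b : Fin (X.m s.succ)), P (mkField s.succ b)) (α : X.Field) :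
    P α := by
  suffices h : ∀ (k : Fin (X.L + 2)) (a : Fin (X.m k)), P (mkField k a) from
    h (ofLex α).1 (ofLex α).2
  exact Fin.cases h0 h1

theorem ktOperator_add (V : X.Field → X.Fun U) (f g : X.Fun U) :
    ktOperator V (f + g) = ktOperator V f + ktOperator V g := by
  simp only [ktOperator, leftDeriv_add, fun_mul_add, fun_sum_add]

theorem ktOperator_smul (V : X.Field → X.Fun U) (c : ℝ) (f : X.Fun U) :
    ktOperator V (c • f) = c • ktOperator V f := by
  simp only [ktOperator, leftDeriv_smul, fun_mul_smul, fun_smul_sum]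

theorem ktOperator_sub (V : X.Field → X.Fun U) (f g : X.Fun U) :
    ktOperator V (f - g) = ktOperator V f - ktOperator V g := by
  rw [fun_sub_eq, fun_sub_eq, ktOperator_add, ktOperator_smul]

/-- The operator `V_α ∂_l/∂Φ*_α` as a linear map. -/
def ktOperatorₗ (V : X.Field → X.Fun U) : X.Fun U →ₗ[ℝ] X.Fun U where
  toFun := ktOperator V
  map_add' := ktOperator_add V
  map_smul' := ktOperator_smul V

theorem ktOperator_sum {ι : Type*} (V : X.Field → X.Fun U) (s : Finset ι) (f : ι → X.Fun U) :
    ktOperator V (∑ i ∈ s, f i) = ∑ i ∈ s, ktOperator V (f i) := map_sum (ktOperatorₗ V) f s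

theorem leftDeriv_anti_gen_of_ne {α : X.Field} {A : X.Var} (h : anti α ≠ A) :
    leftDeriv (anti α) (gen A : X.Fun U) = 0 := by
  classical
  refine fun_ext fun e => by_contra fun he => ?_
  have h1 := gen_supported A _ (coeff_ne_of_leftDeriv he)
  rw [shift_of_not_isReal (not_isReal_anti α)] at h1
  have h2 := DFunLike.congr_fun h1 (anti α)
  rw [Finsupp.add_apply, Finsupp.single_eq_same, Finsupp.single_eq_of_ne h] at h2
  omega

/-- The coefficients of the operator are its values on the antifields. Nilpotency applied to an
antifield therefore says that the operator annihilates every V_β. -/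
theorem ktOperator_gen_anti (V : X.Field → X.Fun U) (β : X.Field) :
    ktOperator V (gen (anti β)) = V β := by
  rw [ktOperator, Finset.sum_eq_single β, leftDeriv_gen_self (not_isReal_anti β), mul_oneFun]
  · intro α _ hα
    rw [leftDeriv_anti_gen_of_ne fun h => hα (anti_injective h), fun_mul_zero]
  · intro h
    exact absurd (Finset.mem_univ β) h

theorem ktOperator_mul_gen (V : X.Field → X.Fun U) {f : X.Fun U} {p : ZMod 2} (hf : HasParity f p)
    (β : X.Field) : ktOperator V (f * gen (fld β)) = ktOperator V f * gen (fld β) := by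
  rw [ktOperator, ktOperator, fun_sum_mul]
  refine Finset.sum_congr rfl fun α _ => ?_
  rw [leftDeriv_mul _ hf, leftDeriv_anti_gen_of_ne (anti_ne_fld α β), fun_mul_zero, fun_smul_zero,
    add_zero, fun_mul_assoc]

/-- The part `V_{α_s} c^{α_s}` of the action that is linear in the ghosts. -/
def linearPart (V : X.Field → X.Fun U) : X.Fun U :=
  ∑ s : Fin (X.L + 1), ∑ b : Fin (X.m s.succ), V (mkField s.succ b) * gen (fld (mkField s.succ b))

theorem linearPart_mem {V : X.Field → X.Fun U} {P : (X.Var →₀ ℕ) → Prop}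
    (h : ∀ β : X.Field, level β ≠ 0 → V β * gen (fld β) ∈ supported U P) :
    linearPart V ∈ supported U P :=
  Submodule.sum_mem _ fun _ _ => Submodule.sum_mem _ fun _ _ => h _ (Fin.succ_ne_zero _)

/-- A family of superfunctions with the degrees of a Koszul–Tate operator. -/
structure HasKTDegrees (V : X.Field → X.Fun U) : Prop where
  ghosts : ∀ α e, (V α).1 e ≠ 0 → numGhosts e = 0
  parity : ∀ α e, (V α).1 e ≠ 0 → parityDegree e = fieldParity α
  afn : ∀ α e, (V α).1 e ≠ 0 → afnDegree e = level α
  gh : ∀ α e, (V α).1 e ≠ 0 → ghDegree e = -((level α : ℕ) : ℤ)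

/-- The ghost number need not be prescribed: in the absence of ghosts it is minus the antifield
number. -/
theorem IsKoszulTate.hasKTDegrees {S₀ : X.Fun U} {Z : Generators X U} {V : X.Field → X.Fun U}
    (hV : IsKoszulTate S₀ Z V) : HasKTDegrees V where
  ghosts := hV.ghostFree
  parity α e he := by
    rw [hV.parity_eq α e he, parity_anti, add_assoc, CharTwo.add_self_eq_zero, add_zero]
  afn α e he := hV.afn_eq α e he
  gh α e he := by
    rw [ghDegree_of_numGhosts_eq_zero (hV.ghostFree α e he), hV.afn_eq α e he]; rfl

/-- The monomials in the image of a Koszul–Tate operator. -/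
theorem ktOperator_mem {V : X.Field → X.Fun U} (hV : HasKTDegrees V) {P Q : (X.Var →₀ ℕ) → Prop}
    {f : X.Fun U} (hf : f ∈ supported U P)
    (h : ∀ e e', numGhosts e = numGhosts e' → afnDegree e + 1 = afnDegree e' →
      ghDegree e = ghDegree e' + 1 → parityDegree e = parityDegree e' + 1 → P e' → Q e) :
    ktOperator V f ∈ supported U Q := by
  refine Submodule.sum_mem _ fun α _ => ?_
  intro e he
  obtain ⟨a, b, rfl, ha, hb⟩ := exists_of_coeff_mul_ne he
  refine h _ (b + shift (anti α)) ?_ ?_ ?_ ?_ (hf _ (coeff_ne_of_leftDeriv hb))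
  · rw [numGhosts_add, numGhosts_add, hV.ghosts α a ha, numGhosts_shift_anti, zero_add, add_zero]
  · rw [afnDegree_add, afnDegree_add, hV.afn α a ha, afnDegree_shift_anti]; ring
  · rw [ghDegree_add, ghDegree_add, hV.gh α a ha, ghDegree_shift_anti]; ring
  · rw [parityDegree_add, parityDegree_add, hV.parity α a ha, parityDegree_shift, parity_anti]
    linear_combination -CharTwo.two_eq_zero (R := ZMod 2)

/-- The parity of V_β equals that of Φ^β and its ghost number is opposite, so the product is even of
ghost number zero. -/
theorem mul_gen_ghost_mem {V : X.Field → X.Fun U} (hV : HasKTDegrees V) {β : X.Field}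
    (hβ : level β ≠ 0) : V β * gen (fld β) ∈ supported U fun e =>
      numGhosts e = 1 ∧ parityDegree e = 0 ∧ ghDegree e = 0 := by
  intro e he
  obtain ⟨a, b, rfl, ha, hb⟩ := exists_of_coeff_mul_ne he
  have hb' := gen_supported _ _ hb
  rw [← shift_of_not_isReal (not_isReal_fld hβ)] at hb'
  rw [hb', numGhosts_add, parityDegree_add, ghDegree_add, hV.ghosts β a ha, hV.parity β a ha,
    hV.gh β a ha, parityDegree_shift, parity_fld, ghDegree_shift_fld, numGhosts_shift_ghost hβ,
    CharTwo.add_self_eq_zero, neg_add_cancel]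
  exact ⟨zero_add 1, rfl, rfl⟩

theorem linearPart_supported {V : X.Field → X.Fun U} (hV : HasKTDegrees V) :
    linearPart V ∈ supported U fun e =>
      numGhosts e = 1 ∧ parityDegree e = 0 ∧ ghDegree e = 0 :=
  linearPart_mem fun _ hβ => mul_gen_ghost_mem hV hβ

/-- The operator does not see the ghost factor and annihilates V_β by nilpotency. -/
theorem ktOperator_linearPart {V : X.Field → X.Fun U} (hV : HasKTDegrees V)
    (hnil : IsNilpotentKT V) : ktOperator V (linearPart V) = 0 := by
  have h : ∀ β, ktOperator V (V β * gen (fld β)) = 0 := fun β => by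
    have h0 := hnil (gen (anti β))
    rw [ktOperator_gen_anti] at h0
    rw [ktOperator_mul_gen V (hV.parity β), h0, fun_zero_mul]
  simp only [linearPart, ktOperator_sum, h, Finset.sum_const_zero]

theorem ktOperator_of_originalOnly (V : X.Field → X.Fun U) {f : X.Fun U} (hf : OriginalOnly f) :
    ktOperator V f = 0 := by
  have h : ∀ α, leftDeriv (anti α) f = 0 := fun α => fun_ext fun e => by_contra fun he => by
    have := (hf _ (coeff_ne_of_leftDeriv he)).2
    rw [numAntifields_add, numAntifields_shift_anti] at this
    omega
  simp only [ktOperator, h, fun_mul_zero, Finset.sum_const_zero]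

/-! ### Extensions of the action -/

/-- `S` is even, has ghost number zero, and is of the form `S₀ + V_{α_s} c^{α_s} + O(c²)`. -/
structure IsExtension (S₀ : X.Fun U) (V : X.Field → X.Fun U) (S : X.Fun U) : Prop where
  even : HasParity S 0
  gh : HasGh S 0
  form : IsOGhost 2 (S - (S₀ + linearPart V))

theorem ghDegree_of_original {e : X.Var →₀ ℕ} (h : numGhosts e = 0 ∧ numAntifields e = 0) :
    ghDegree e = 0 := by
  rw [ghDegree_of_numGhosts_eq_zero h.1, afnDegree_of_numAntifields_eq_zero h.2, Nat.cast_zero,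
    neg_zero]

theorem isExtension_start {S₀ : X.Fun U} {V : X.Field → X.Fun U} (hS₀ : OriginalOnly S₀)
    (heven : HasParity S₀ 0) (hV : HasKTDegrees V) : IsExtension S₀ V (S₀ + linearPart V) where
  even := (supported U fun e => parityDegree e = 0).add_mem heven
    (supported_mono (fun _ h => h.2.1) (linearPart_supported hV))
  gh := (supported U fun e => ghDegree e = 0).add_mem (fun e he => ghDegree_of_original (hS₀ e he))
    (supported_mono (fun _ h => h.2.2) (linearPart_supported hV))
  form e he := absurd (by rw [coeff_sub, sub_self]) he

/-- The first-order data that relate an action to a Koszul–Tate operator. -/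
structure IsKTAction (S₀ : X.Fun U) (V : X.Field → X.Fun U) : Prop where
  original : OriginalOnly S₀
  even : HasParity S₀ 0
  degrees : HasKTDegrees V
  nilpotent : IsNilpotentKT V
  deriv : ∀ i : Fin (X.m 0), V (mkField 0 i) = rightDeriv (fld (mkField 0 i)) S₀

/-! ### Ghost and antifield-number estimates for brackets with the action -/

section

variable {S₀ : X.Fun U} {V : X.Field → X.Fun U}

theorem rightDeriv_linearPart (hV : HasKTDegrees V) (s : Fin (X.L + 1)) (b : Fin (X.m s.succ)) :
    rightDeriv (fld (mkField s.succ b)) (linearPart V) = V (mkField s.succ b) := by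
  classical
  have hne : ∀ β, level β ≠ 0 → mkField s.succ b ≠ β →
      rightDeriv (fld (mkField s.succ b)) (V β * gen (fld β)) = 0 := by
    intro β hβ hne
    refine fun_ext fun e => by_contra fun he => ?_
    obtain ⟨a, c, hac, ha, hc⟩ := exists_of_coeff_mul_ne (coeff_ne_of_rightDeriv he)
    have hc' := gen_supported _ _ hc
    have h1 := hV.ghosts β a ha
    have h2 := (Finset.sum_eq_zero_iff.1 h1) (fld (mkField s.succ b)) (Finset.mem_univ _)
    have hg : level (mkField s.succ b) ≠ 0 := Fin.succ_ne_zero _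
    rw [if_pos (isGhost_fld.2 hg)] at h2
    rw [shift_of_not_isReal (not_isReal_fld hg)] at hac
    have h3 := DFunLike.congr_fun hac (fld (mkField s.succ b))
    rw [Finsupp.add_apply, Finsupp.add_apply, hc', Finsupp.single_eq_same, h2,
      Finsupp.single_eq_of_ne fun h => hne (fld_injective h)] at h3
    omega
  rw [linearPart, rightDeriv_sum, Finset.sum_eq_single s, rightDeriv_sum, Finset.sum_eq_single b]
  · refine rightDeriv_mul_gen (not_isReal_fld (Fin.succ_ne_zero s)) fun e he => ?_
    have h2 := (Finset.sum_eq_zero_iff.1 (hV.ghosts _ e he)) (fld (mkField s.succ b))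
      (Finset.mem_univ _)
    have hg : level (mkField s.succ b) ≠ 0 := Fin.succ_ne_zero _
    rwa [if_pos (isGhost_fld.2 hg)] at h2
  · intro b' _ hb'
    refine hne _ (Fin.succ_ne_zero _) fun h => hb' ?_
    have := congrArg ofLex h
    simp only [mkField, ofLex_toLex, Sigma.mk.injEq, heq_eq_eq, true_and] at this
    exact this.symm
  · intro h
    exact absurd (Finset.mem_univ b) h
  · intro s' _ hs'
    rw [rightDeriv_sum]
    refine Finset.sum_eq_zero fun b' _ => hne _ (Fin.succ_ne_zero _) fun h => hs' ?_
    exact Fin.succ_injective _ (congrArg level h).symm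
  · intro h
    exact absurd (Finset.mem_univ s) h

/-- To lowest order in the ghosts, V_α is the derivative of the action along Φ^α. For original
fields this is the derivative of S₀, for ghosts it is the coefficient in the linear part; O(c²)
terms keep at least one ghost. -/
theorem IsExtension.rightDeriv_sub (h0 : IsKTAction S₀ V) {S : X.Fun U} (hS : IsExtension S₀ V S)
    (α : X.Field) :
    rightDeriv (fld α) S - V α ∈ supported U fun e => 1 ≤ numGhosts e := by
  have h1 : rightDeriv (fld α) (S - (S₀ + linearPart V)) ∈ supported U fun e => 1 ≤ numGhosts e :=
    supported_mono (fun e he => by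
      have := numGhosts_shift_fld_le α
      rw [numGhosts_add] at he
      omega) (supported_rightDeriv hS.form (fld α))
  have h2 : rightDeriv (fld α) (S₀ + linearPart V) - V α ∈
      supported U fun e => 1 ≤ numGhosts e := by
    refine field_cases (P := fun α => rightDeriv (fld α) (S₀ + linearPart V) - V α ∈
      supported U fun e => 1 ≤ numGhosts e) (fun i => ?_) (fun s b => ?_) α
    · rw [rightDeriv_add, ← h0.deriv, fun_add_sub_cancel_left]
      refine supported_mono (fun e he => ?_)
        (supported_rightDeriv (linearPart_supported h0.degrees) _)
      rw [numGhosts_add, numGhosts_shift_original (level_mkField _ _)] at he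
      omega
    · rw [rightDeriv_add, rightDeriv_linearPart h0.degrees, fun_add_sub_cancel_right]
      intro e he
      have := (h0.original _ (coeff_ne_of_rightDeriv he)).1
      rw [numGhosts_add, numGhosts_shift_ghost (α := mkField s.succ b) (Fin.succ_ne_zero s)] at this
      omega
  have h3 : rightDeriv (fld α) S - V α = rightDeriv (fld α) (S - (S₀ + linearPart V)) +
      (rightDeriv (fld α) (S₀ + linearPart V) - V α) := by
    rw [FieldContent.rightDeriv_sub, fun_sub_add_sub_cancel]
  rw [h3]
  exact (supported U _).add_mem h1 h2

/-- The ghost-free part of S is S₀, which contains no antifields. -/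
theorem IsExtension.leftDeriv_anti (h0 : IsKTAction S₀ V) {S : X.Fun U} (hS : IsExtension S₀ V S)
    (α : X.Field) : leftDeriv (anti α) S ∈ supported U fun e => 1 ≤ numGhosts e := by
  intro e he
  have h := coeff_ne_of_leftDeriv he
  by_contra hlt
  have hg : numGhosts (e + shift (anti α)) = 0 := by
    rw [numGhosts_add, numGhosts_shift_anti]; omega
  have h1 : (S - (S₀ + linearPart V)).1 (e + shift (anti α)) = 0 := by
    by_contra h1
    have := hS.form _ h1
    omega
  have h2 : (linearPart V).1 (e + shift (anti α)) = 0 := by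
    by_contra h2
    have := (linearPart_supported h0.degrees _ h2).1
    omega
  have h3 : S₀.1 (e + shift (anti α)) ≠ 0 := fun h3 => h (by
    rw [coeff_sub, coeff_add, h2, h3] at h1
    simpa using h1)
  have := (h0.original _ h3).2
  rw [numAntifields_add, numAntifields_shift_anti] at this
  omega

theorem antibracket_self_of_even {S : X.Fun U} (hS : HasParity S 0) :
    antibracket S S = (2 : ℝ) • ∑ α : X.Field, rightDeriv (fld α) S * leftDeriv (anti α) S := by
  rw [antibracket_of_even hS, sum_var, fun_smul_sum]
  refine Finset.sum_congr rfl fun α _ => ?_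
  have h : leftDeriv (anti α) S * leftDeriv (fld α) S =
      leftDeriv (fld α) S * leftDeriv (anti α) S := by
    rw [mul_comm_of_parity (hS.leftDeriv (fld α)) (hS.leftDeriv (anti α)), parity_fld, parity_anti]
    have : (0 + fieldParity α) * (0 + (fieldParity α + 1)) = 0 := by
      generalize fieldParity α = p; revert p; decide
    rw [this, sgn_zero, fun_one_smul]
  rw [dual_fld, dual_anti, h, conjSign_fld, conjSign_anti, rightDeriv_of_even _ hS, ← fun_add_smul,
    parity_fld]
  simp only [fun_smul_mul, fun_smul_smul, two_mul]

/-- The master equation holds up to terms that are quadratic in the ghosts. -/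
theorem IsExtension.antibracket_ghosts (h0 : IsKTAction S₀ V) {S : X.Fun U}
    (hS : IsExtension S₀ V S) : antibracket S S ∈ supported U fun e => 2 ≤ numGhosts e := by
  rw [antibracket_self_of_even hS.even]
  refine (supported U _).smul_mem _ ?_
  -- Splitting off V_α from the first factor leaves the Koszul–Tate operator applied to S, which
  -- only sees the O(c²) part, and a product of two factors each containing a ghost.
  have h1 : ∑ α : X.Field, rightDeriv (fld α) S * leftDeriv (anti α) S =
      ktOperator V (S - (S₀ + linearPart V)) +
        ∑ α : X.Field, (rightDeriv (fld α) S - V α) * leftDeriv (anti α) S := by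
    rw [ktOperator_sub, ktOperator_add, ktOperator_of_originalOnly V h0.original,
      ktOperator_linearPart h0.degrees h0.nilpotent, add_zero, fun_sub_zero, ktOperator,
      ← fun_sum_add]
    refine Finset.sum_congr rfl fun α _ => ?_
    rw [← fun_add_mul, fun_add_sub_cancel]
  rw [h1]
  refine (supported U _).add_mem (ktOperator_mem h0.degrees hS.form ?_) ?_
  · intro e e' h _ _ _ h'
    exact h ▸ h'
  · refine Submodule.sum_mem _ fun α _ => supported_mul (hS.rightDeriv_sub h0 α)
      (hS.leftDeriv_anti h0 α) fun a b ha hb => ?_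
    rw [numGhosts_add]
    omega

theorem antibracket_gh {S : X.Fun U} (hS : HasGh S 0) : HasGh (antibracket S S) 1 := by
  refine antibracket_mem hS hS (fun α a b ha hb => ?_) (fun α a b ha hb => ?_) <;>
  · rw [ghDegree_add] at ha hb ⊢
    rw [ghDegree_shift_fld] at *
    rw [ghDegree_shift_anti] at *
    omega

/-- In each term of the bracket an antifield is removed from one factor only; the other keeps its
whole antifield number, so the common lower bound survives. -/
theorem antibracket_afn {t : ℕ} {f g : X.Fun U}
    (hf : f ∈ supported U fun e => t ≤ afnDegree e)
    (hg : g ∈ supported U fun e => t ≤ afnDegree e) :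
    antibracket f g ∈ supported U fun e => t ≤ afnDegree e := by
  refine antibracket_mem hf hg (fun α a b ha hb => ?_) (fun α a b ha hb => ?_)
  · rw [afnDegree_add, afnDegree_shift_fld] at ha
    rw [afnDegree_add]
    omega
  · rw [afnDegree_add, afnDegree_shift_fld] at hb
    rw [afnDegree_add]
    omega

/-- The largest antifield number of a single antifield is L + 2, and the bracket removes at most one
antifield from a given factor. This bounds the loss uniformly, as the passage to the limit requires.
-/
theorem antibracket_afn_left {t : ℕ} {f : X.Fun U}
    (hf : f ∈ supported U fun e => t ≤ afnDegree e) (g : X.Fun U) :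
    antibracket f g ∈ supported U fun e => t ≤ afnDegree e + (X.L + 2) := by
  refine antibracket_mem (Q := fun _ => True) hf (fun _ _ => trivial) (fun α a b ha _ => ?_)
    (fun α a b ha _ => ?_)
  · rw [afnDegree_add, afnDegree_shift_fld] at ha
    rw [afnDegree_add]
    omega
  · rw [afnDegree_add, afnDegree_shift_anti] at ha
    rw [afnDegree_add]
    have := (level α).2
    omega

theorem antibracket_afn_right {t : ℕ} (f : X.Fun U) {g : X.Fun U}
    (hg : g ∈ supported U fun e => t ≤ afnDegree e) :
    antibracket f g ∈ supported U fun e => t ≤ afnDegree e + (X.L + 2) := by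
  refine antibracket_mem (P := fun _ => True) (fun _ _ => trivial) hg (fun α a b _ hb => ?_)
    (fun α a b _ hb => ?_)
  · rw [afnDegree_add, afnDegree_shift_anti] at hb
    rw [afnDegree_add]
    have := (level α).2
    omega
  · rw [afnDegree_add, afnDegree_shift_fld] at hb
    rw [afnDegree_add]
    omega

/-- The leading part of `(S, ·)` is the Koszul–Tate operator. -/
theorem IsExtension.antibracket_sub_kt (h0 : IsKTAction S₀ V) {S : X.Fun U}
    (hS : IsExtension S₀ V S) {t : ℕ} {f : X.Fun U}
    (hf : f ∈ supported U fun e => t ≤ afnDegree e) :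
    antibracket S f - ktOperator V f ∈ supported U fun e => t ≤ afnDegree e := by
  have h1 : antibracket S f - ktOperator V f = ∑ α : X.Field,
      ((rightDeriv (fld α) S - V α) * leftDeriv (anti α) f
        - rightDeriv (anti α) S * leftDeriv (fld α) f) := by
    rw [antibracket, ktOperator]
    rw [fun_sum_sub]
    refine Finset.sum_congr rfl fun α _ => ?_
    rw [fun_sub_mul, fun_sub_right_comm]
  rw [h1]
  refine Submodule.sum_mem _ fun α _ => supported_sub ?_ ?_
  -- This difference has ghost number minus the level of α and contains a ghost, so its antifield
  -- number is at least the level plus one. That makes up for the antifield removed from f.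
  · have hgh : rightDeriv (fld α) S - V α ∈
        supported U fun e => ghDegree e = -((level α : ℕ) : ℤ) := by
      refine supported_sub (supported_mono (fun e he => ?_) (supported_rightDeriv hS.gh (fld α)))
        (h0.degrees.gh α)
      rw [ghDegree_add, ghDegree_shift_fld] at he
      omega
    refine supported_mul (supported_and hgh (hS.rightDeriv_sub h0 α))
      (supported_leftDeriv hf (anti α)) fun a b ha hb => ?_
    have := numGhosts_le a
    rw [afnDegree_add, afnDegree_shift_anti] at hb
    rw [afnDegree_add]
    omega
  · refine supported_mul (P := fun _ => True) (fun _ _ => trivial)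
      (supported_leftDeriv hf (fld α)) fun a b _ hb => ?_
    rw [afnDegree_add, afnDegree_shift_fld] at hb
    rw [afnDegree_add]
    omega

end

end BV.FieldContent

namespace BV.FieldContent

variable {X : FieldContent} {U : Opens X.Body} {S₀ : X.Fun U} {V : X.Field → X.Fun U}

/-! ### The recursive construction -/

/-- A primitive of a Koszul–Tate cocycle can be chosen with the appropriate degrees. -/
theorem exists_homogeneous_primitive (hV : HasKTDegrees V) {r : ℕ} {B g : X.Fun U}
    (hB : B = ktOperator V g) (hdeg : B ∈ supported U fun e => afnDegree e = r ∧
      2 ≤ numGhosts e ∧ parityDegree e = 1 ∧ ghDegree e = 1) :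
    ∃ g' ∈ supported U (fun e => afnDegree e = r + 1 ∧ 2 ≤ numGhosts e ∧ parityDegree e = 0 ∧
      ghDegree e = 0), ktOperator V g' = B := by
  set P : (X.Var →₀ ℕ) → Prop := fun e => afnDegree e = r + 1 ∧ 2 ≤ numGhosts e ∧
    parityDegree e = 0 ∧ ghDegree e = 0
  set Q : (X.Var →₀ ℕ) → Prop := fun e => afnDegree e = r ∧
      2 ≤ numGhosts e ∧ parityDegree e = 1 ∧ ghDegree e = 1
  -- The operator shifts all four degrees by constants, so the monomials in `P` are mapped into `Q`
  -- and all others outside `Q`. Since B lies in `Q`, the rest of g contributes nothing to it.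
  have hPQ : ∀ e e' : X.Var →₀ ℕ, numGhosts e = numGhosts e' → afnDegree e + 1 = afnDegree e' →
      ghDegree e = ghDegree e' + 1 → parityDegree e = parityDegree e' + 1 → (P e' ↔ Q e) := by
    intro e e' h1 h2 h3 h4
    have h5 : parityDegree e' = 0 ↔ parityDegree e = 1 := by rw [h4, add_eq_right]
    have h6 : ghDegree e' = 0 ↔ ghDegree e = 1 := by omega
    have h7 : afnDegree e' = r + 1 ↔ afnDegree e = r := by omega
    simp only [P, Q, h5, h6, h7, h1]
  refine ⟨restrict P g, restrict_supported P g, ?_⟩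
  have h1 : ktOperator V (restrict P g) ∈ supported U Q :=
    ktOperator_mem hV (restrict_supported P g) fun e e' h1 h2 h3 h4 h => (hPQ e e' h1 h2 h3 h4).1 h
  have h2 : ktOperator V (g - restrict P g) ∈ supported U fun e => ¬ Q e :=
    ktOperator_mem hV sub_restrict_supported
      fun e e' h1 h2 h3 h4 h h' => h ((hPQ e e' h1 h2 h3 h4).2 h')
  rw [ktOperator_sub, ← hB] at h2
  have h3 := eq_zero_of_supported (supported_sub hdeg h1) h2 fun _ h h' => h' h
  refine fun_ext fun e => ?_
  have h4 := congrArg (fun f : X.Fun U => f.1 e) h3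
  rw [coeff_sub, coeff_zero, sub_eq_zero] at h4
  exact h4.symm

theorem IsExtension.add {S T : X.Fun U} (hS : IsExtension S₀ V S)
    (hT : T ∈ supported U fun e => 2 ≤ numGhosts e ∧ parityDegree e = 0 ∧ ghDegree e = 0) :
    IsExtension S₀ V (S + T) where
  even := (supported U fun e => parityDegree e = 0).add_mem hS.even
    (supported_mono (fun _ h => h.2.1) hT)
  gh := (supported U fun e => ghDegree e = 0).add_mem hS.gh (supported_mono (fun _ h => h.2.2) hT)
  form := by
    have h : S + T - (S₀ + linearPart V) = S - (S₀ + linearPart V) + T :=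
      fun_ext fun e => by simp only [coeff_add, coeff_sub]; abel
    rw [h]
    exact (supported U fun e => 2 ≤ numGhosts e).add_mem hS.form
      (supported_mono (fun _ h => h.1) hT)

theorem antibracket_add_self {S T : X.Fun U} (hS : HasParity S 0) (hT : HasParity T 0) :
    antibracket (S + T) (S + T) =
      antibracket S S + (2 : ℝ) • antibracket S T + antibracket T T := by
  rw [antibracket_add_left, antibracket_add_right, antibracket_add_right, antibracket_comm hT hS,
    show (2 : ℝ) = 1 + 1 by norm_num, fun_add_smul, fun_one_smul]
  simp only [add_assoc]

/-- The part of lowest antifield number of `(S, S)` is a Koszul–Tate cocycle. -/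
theorem ktOperator_restrict_antibracket (h0 : IsKTAction S₀ V) {S : X.Fun U}
    (hS : IsExtension S₀ V S) {r : ℕ}
    (hr : antibracket S S ∈ supported U fun e => r ≤ afnDegree e) :
    ktOperator V (restrict (fun e => afnDegree e = r) (antibracket S S)) = 0 := by
  set W := antibracket S S
  set B := restrict (fun e => afnDegree e = r) W
  -- By the Jacobi identity, the Koszul–Tate image of W is minus the difference between (S, W) and
  -- that image, which starts at r. The image of W - B also starts at r, since W - B starts at r +
  -- 1. So the image of B starts at r, while by degree it lives at r - 1.
  have h1 : ktOperator V W ∈ supported U fun e => r ≤ afnDegree e := by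
    have h := hS.antibracket_sub_kt h0 hr
    rw [antibracket_antibracket_self hS.even] at h
    have h' := supported_sub h ((supported U fun e => r ≤ afnDegree e).zero_mem)
    intro e he
    refine h e fun h0 => he ?_
    rwa [coeff_sub, coeff_zero, zero_sub, neg_eq_zero] at h0
  have h2 : ktOperator V (W - B) ∈ supported U fun e => r ≤ afnDegree e :=
    ktOperator_mem h0.degrees
      (supported_and (sub_restrict_mem hr) (sub_restrict_supported (P := fun e => afnDegree e = r)))
      fun e e' _ h _ _ h' => by omega
  have h3 : ktOperator V B ∈ supported U fun e => r ≤ afnDegree e := by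
    have h := supported_sub h1 h2
    rw [ktOperator_sub] at h
    intro e he
    refine h e fun h0 => he ?_
    rwa [coeff_sub, coeff_sub, sub_sub_cancel] at h0
  exact eq_zero_of_supported h3 (ktOperator_mem (Q := fun e => afnDegree e + 1 = r) h0.degrees
    (restrict_supported _ W) fun e e' _ h _ _ h' => h.trans h') fun e h h' => by omega

/-- One step of the recursive solution of the master equation. -/
theorem IsExtension.exists_next (h0 : IsKTAction S₀ V) (hacyc : IsAcyclicKT V) {S : X.Fun U}
    (hS : IsExtension S₀ V S) {r : ℕ} (hpos : 0 < r)
    (hr : antibracket S S ∈ supported U fun e => r ≤ afnDegree e) :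
    ∃ S', IsExtension S₀ V S' ∧ (antibracket S' S' ∈ supported U fun e => r + 1 ≤ afnDegree e) ∧
      S' - S ∈ supported U fun e => r + 1 ≤ afnDegree e := by
  set W := antibracket S S with hW
  set B := restrict (fun e => afnDegree e = r) W with hBdef
  have hWdeg : W ∈ supported U fun e => 2 ≤ numGhosts e ∧ parityDegree e = 1 ∧ ghDegree e = 1 :=
    supported_and (hS.antibracket_ghosts h0) (supported_and
      (fun e he => by rw [hS.even.antibracket hS.even e he, zero_add]) (antibracket_gh hS.gh))
  obtain ⟨g, hg⟩ := hacyc r B hpos (restrict_supported _ W)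
    (ktOperator_restrict_antibracket h0 hS hr)
  obtain ⟨g', hg', hgB⟩ := exists_homogeneous_primitive h0.degrees hg
    (supported_and (restrict_supported _ W) (restrict_mem hWdeg))
  -- The factor -1/2 compensates the 2 in the cross term 2(S, T), whose leading part then becomes
  -- -B.
  set T := (-(1 / 2) : ℝ) • g' with hT
  have hTdeg := (supported U _).smul_mem (-(1 / 2) : ℝ) hg'
  rw [← hT] at hTdeg
  have hTafn : T ∈ supported U fun e => r + 1 ≤ afnDegree e :=
    supported_mono (fun _ h => h.1.ge) hTdeg
  refine ⟨S + T, hS.add (supported_mono (fun _ h => h.2) hTdeg), ?_, ?_⟩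
  · have h1 := hS.antibracket_sub_kt h0 hTafn
    have h2 : antibracket (S + T) (S + T) =
        (W - B) + (2 : ℝ) • (antibracket S T - ktOperator V T) + antibracket T T := by
      have h3 : (2 : ℝ) • ktOperator V T = (-1 : ℝ) • B := by
        rw [hT, ktOperator_smul, hgB, fun_smul_smul]; norm_num
      rw [antibracket_add_self hS.even (supported_mono (fun _ h => h.2.2.1) hTdeg)]
      refine fun_ext fun e => ?_
      have h4 := congrArg (fun f : X.Fun U => f.1 e) h3
      simp only [coeff_smul, coeff_add, coeff_sub, smul_sub] at h4 ⊢
      rw [h4, neg_one_smul]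
      abel
    rw [h2]
    refine (supported U _).add_mem ((supported U _).add_mem ?_ ((supported U _).smul_mem _ h1))
      (antibracket_afn hTafn hTafn)
    exact supported_mono (fun _ h => lt_of_le_of_ne h.1 (Ne.symm h.2))
      (supported_and (sub_restrict_mem hr) sub_restrict_supported)
  · rw [fun_add_sub_cancel_left]
    exact hTafn

theorem exists_dependent_seq {α : Type*} (P : ℕ → α → Prop) (R : ℕ → α → α → Prop)
    (h0 : ∃ a, P 0 a) (hs : ∀ n a, P n a → ∃ b, P (n + 1) b ∧ R n a b) :
    ∃ u : ℕ → α, ∀ n, P n (u n) ∧ R n (u n) (u (n + 1)) := by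
  choose! F hF using hs
  obtain ⟨a, ha⟩ := h0
  refine ⟨fun n => Nat.rec a (fun n b => F n b) n, fun n => ?_⟩
  have h : P n (Nat.rec a (fun n b => F n b) n) := by
    induction n with
    | zero => exact ha
    | succ n ih => exact (hF n _ ih).1
  exact ⟨h, (hF n _ h).2⟩

/-- Two ghosts at total ghost number 1 force a positive antifield number. This starts the recursion
within the range of acyclicity. -/
theorem IsExtension.antibracket_afn_pos (h0 : IsKTAction S₀ V) {S : X.Fun U}
    (hS : IsExtension S₀ V S) : antibracket S S ∈ supported U fun e => 0 + 1 ≤ afnDegree e :=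
  supported_mono (fun e h => by
    have := numGhosts_le e
    have := h.1
    have := h.2
    omega) (supported_and (hS.antibracket_ghosts h0) (antibracket_gh hS.gh))

/-- The coefficientwise limit of a sequence of superfunctions. -/
def limitFun (u : ℕ → X.Fun U) : X.Fun U :=
  ⟨fun e => (u (afnDegree e)).1 e, fun _ he => coeff_eq_zero _ he⟩

/-- The step from `u n` to `u (n + 1)` affects only antifield numbers from n + 2 on, so the
coefficient of `e` is constant from the index `afnDegree e` on. -/
theorem limitFun_sub {u : ℕ → X.Fun U}
    (hu : ∀ n, u (n + 1) - u n ∈ supported U fun e => n + 2 ≤ afnDegree e) (n : ℕ) :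
    limitFun u - u n ∈ supported U fun e => n + 1 ≤ afnDegree e := by
  have key : ∀ (e : X.Var →₀ ℕ) (k : ℕ), (u (afnDegree e + k)).1 e = (u (afnDegree e)).1 e := by
    intro e k
    induction k with
    | zero => rfl
    | succ k ih =>
      rw [← ih]
      by_contra h
      have := hu (afnDegree e + k) e (by rw [coeff_sub]; exact sub_ne_zero.2 h)
      omega
  intro e he
  by_contra hlt
  obtain ⟨k, hk⟩ := Nat.exists_eq_add_of_le (show afnDegree e ≤ n by omega)
  refine he ?_
  rw [coeff_sub, hk, key e k]
  exact sub_self _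

/-- Existence of a solution of the master equation with given Koszul–Tate operator. -/
theorem exists_master (h0 : IsKTAction S₀ V) (hacyc : IsAcyclicKT V) :
    ∃ S, IsExtension S₀ V S ∧ antibracket S S = 0 := by
  obtain ⟨u, hu⟩ := exists_dependent_seq
    (fun n S => IsExtension S₀ V S ∧ antibracket S S ∈ supported U fun e => n + 1 ≤ afnDegree e)
    (fun n S S' => S' - S ∈ supported U fun e => n + 2 ≤ afnDegree e)
    ⟨_, isExtension_start h0.original h0.even h0.degrees,
      (isExtension_start h0.original h0.even h0.degrees).antibracket_afn_pos h0⟩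
    (fun n S hS => by
      obtain ⟨S', h1, h2, h3⟩ := hS.1.exists_next h0 hacyc n.succ_pos hS.2
      exact ⟨S', ⟨h1, h2⟩, h3⟩)
  have hlim := limitFun_sub fun n => (hu n).2
  -- Being an extension is a condition on each coefficient separately, so the limit inherits it.
  refine ⟨limitFun u, ⟨fun e he => (hu (afnDegree e)).1.1.even e he,
    fun e he => (hu (afnDegree e)).1.1.gh e he, fun e he => (hu (afnDegree e)).1.1.form e he⟩, ?_⟩
  refine fun_ext fun e => by_contra fun he => ?_
  -- The approximation must be ahead by the maximal loss L + 2 of one bracket, so that the remainder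
  -- cannot reach the antifield number of `e`.
  set n := afnDegree e + (X.L + 2) with hn
  set T := limitFun u - u n with hT
  have h1 : limitFun u = u n + T := (fun_add_sub_cancel _ _).symm
  have hTn : T ∈ supported U fun e => n + 1 ≤ afnDegree e := hlim n
  have h2 : antibracket (limitFun u) (limitFun u) ∈
      supported U fun e => n + 1 ≤ afnDegree e + (X.L + 2) := by
    rw [h1, antibracket_add_left, antibracket_add_right]
    exact (supported U _).add_mem ((supported U _).add_mem
      (supported_mono (fun _ h => h.trans (Nat.le_add_right _ _)) (hu n).1.2)
      (antibracket_afn_right _ hTn)) (antibracket_afn_left hTn _)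
  have := h2 e he
  omega

end BV.FieldContent

namespace BV

/-! ### Ranks of block matrices -/

section Rank

variable {𝕜 : Type*} [Field 𝕜] {K : Type*} [Fintype K] {R C : K → Type*} 
  [∀ k, Fintype (C k)]

theorem mulVec_block {M : Matrix (Σ k, R k) (Σ k, C k) 𝕜}
    (h : ∀ k l i j, k ≠ l → M ⟨k, i⟩ ⟨l, j⟩ = 0) (v : (Σ k, C k) → 𝕜) (k : K) (i : R k) :
    M.mulVec v ⟨k, i⟩ =
      (M.submatrix (Sigma.mk k) (Sigma.mk k)).mulVec (fun j => v ⟨k, j⟩) i := by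
  simp only [Matrix.mulVec, dotProduct, Matrix.submatrix_apply, Fintype.sum_sigma]
  refine Finset.sum_eq_single_of_mem k (Finset.mem_univ k) fun l _ hl => ?_
  exact Finset.sum_eq_zero fun j _ => by rw [h k l i j hl.symm, zero_mul]

/-- The rank of a block-diagonal matrix. -/
theorem rank_sigma_block {M : Matrix (Σ k, R k) (Σ k, C k) 𝕜}
    (h : ∀ k l i j, k ≠ l → M ⟨k, i⟩ ⟨l, j⟩ = 0) :
    M.rank = ∑ k, (M.submatrix (Sigma.mk k : R k → _) (Sigma.mk k : C k → _)).rank := by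
  let B := fun k => M.submatrix (Sigma.mk k : R k → _) (Sigma.mk k : C k → _)
  let f : LinearMap.range M.mulVecLin →ₗ[𝕜] (k : K) → LinearMap.range (B k).mulVecLin :=
    LinearMap.pi fun k =>
      { toFun := fun y => ⟨fun i => y.1 ⟨k, i⟩, by
          obtain ⟨v, hv⟩ := y.2
          refine ⟨fun j => v ⟨k, j⟩, funext fun i => ?_⟩
          rw [← hv]
          exact (mulVec_block h v k i).symm⟩
        map_add' := fun _ _ => rfl
        map_smul' := fun _ _ => rfl }
  -- The range of a block-diagonal matrix is the product of the ranges of its blocks: preimages may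
  -- be chosen blockwise.
  have hf : Function.Bijective f := by
    constructor
    · intro y z hyz
      refine Subtype.ext (funext fun p => ?_)
      have := congrArg Subtype.val (congrFun hyz p.1)
      exact congrFun this p.2
    · intro y
      choose v hv using fun k => (y k).2
      refine ⟨⟨M.mulVec fun p => v p.1 p.2, ⟨_, rfl⟩⟩,
        funext fun k => Subtype.ext (funext fun i => ?_)⟩
      rw [← hv k]
      exact mulVec_block h _ k i
  have := (LinearEquiv.ofBijective f hf).finrank_eq
  rw [Module.finrank_pi_fintype] at this
  exact this

/-- Rows and columns are labelled independently, so that off-diagonal blocks, such as those coupling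
ghosts to antifields, can also be treated as diagonal ones. -/
theorem rank_block [∀ k, Fintype (R k)] {m n : Type*} [Fintype m] [Fintype n] (M : Matrix m n 𝕜)
    (r : (k : K) → R k → m) (c : (k : K) → C k → n)
    (hr : Function.Bijective fun p : Σ k, R k => r p.1 p.2)
    (hc : Function.Bijective fun p : Σ k, C k => c p.1 p.2)
    (h : ∀ k l i j, k ≠ l → M (r k i) (c l j) = 0) :
    M.rank = ∑ k, (M.submatrix (r k) (c k)).rank := by
  rw [← Matrix.rank_submatrix M (Equiv.ofBijective _ hr) (Equiv.ofBijective _ hc),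
    rank_sigma_block]
  · rfl
  · exact h

end Rank

namespace FieldContent

variable {X : FieldContent}

/-- The alternating sums M_s telescope: after the first term, the summands of two consecutive ones
are opposite. -/
theorem rankM_castSucc (s : Fin (X.L + 1)) :
    X.rankM s.castSucc + X.rankM s.succ = X.m s.castSucc := by
  have h : Finset.Ici s.castSucc = insert s.castSucc (Finset.Ici s.succ) := by
    ext j
    simp only [Finset.mem_Ici, Finset.mem_insert, Fin.le_def, Fin.ext_iff, Fin.val_castSucc,
      Fin.val_succ]
    omega
  rw [rankM, h, Finset.sum_insert (by simp), rankM, add_assoc, ← Finset.sum_add_distrib,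
    Finset.sum_eq_zero]
  · simp
  · intro j hj
    rw [Finset.mem_Ici, Fin.le_def, Fin.val_succ] at hj
    rw [Fin.val_succ, Fin.val_castSucc, show (j : ℕ) - s = ((j : ℕ) - (s + 1)) + 1 by omega,
      pow_succ]
    ring

theorem rankM_last : X.rankM (Fin.last _) = X.m (Fin.last _) := by
  have h : Finset.Ici (Fin.last (X.L + 1)) = {Fin.last _} := by
    ext j
    simp only [Finset.mem_Ici, Finset.mem_singleton, Fin.last_le_iff]
  rw [rankM, h, Finset.sum_singleton, Nat.sub_self, pow_zero, one_mul]

/-- Summing M_s + M_{s+1} = m_s over all stages counts every M_s twice, except M_{-1}, which occurs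
once. -/
theorem sum_rankM : X.rankM 0 + 2 * ∑ s : Fin (X.L + 1), X.rankM s.succ = ∑ k, (X.m k : ℤ) := by
  have h1 := Fin.sum_univ_succ X.rankM
  have h2 := Fin.sum_univ_castSucc X.rankM
  rw [Fin.sum_univ_castSucc fun k => (X.m k : ℤ), ← rankM_last,
    Finset.sum_congr rfl fun s _ => (rankM_castSucc s).symm, Finset.sum_add_distrib]
  linarith

theorem card_field : Fintype.card X.Field = ∑ k, X.m k := by
  rw [← Fintype.card_congr (toLex (α := Σ k, Fin (X.m k))), Fintype.card_sigma]
  simp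

/-! ### Blocks of the Hessian -/

variable (X) in
/-- The labels of the blocks of the Hessian: the original fields, for each stage the ghosts and the
antifields of the preceding stage, and the antifields of the last stage. -/
abbrev Block : Type := Unit ⊕ Fin (X.L + 1) ⊕ Fin (X.L + 1) ⊕ Unit

/-- The number of rows in a block. -/
def rowCard : X.Block → ℕ
  | .inl _ => X.m 0
  | .inr (.inl s) => X.m s.succ
  | .inr (.inr (.inl s)) => X.m s.castSucc
  | .inr (.inr (.inr _)) => X.m (Fin.last _)

/-- The number of columns in a block. -/
def colCard : X.Block → ℕ
  | .inl _ => X.m 0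
  | .inr (.inl s) => X.m s.castSucc
  | .inr (.inr (.inl s)) => X.m s.succ
  | .inr (.inr (.inr _)) => X.m (Fin.last _)

/-- The rows of a block. -/
def rowVar : (k : X.Block) → Fin (rowCard k) → X.Var
  | .inl _, i => fld (mkField 0 i)
  | .inr (.inl s), b => fld (mkField s.succ b)
  | .inr (.inr (.inl s)), a => anti (mkField s.castSucc a)
  | .inr (.inr (.inr _)), a => anti (mkField (Fin.last _) a)

/-- The columns of a block. -/
def colVar : (k : X.Block) → Fin (colCard k) → X.Var
  | .inl _, i => fld (mkField 0 i)
  | .inr (.inl s), a => anti (mkField s.castSucc a)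
  | .inr (.inr (.inl s)), b => fld (mkField s.succ b)
  | .inr (.inr (.inr _)), a => anti (mkField (Fin.last _) a)

theorem card_var : Fintype.card X.Var = Fintype.card X.Field + Fintype.card X.Field := by
  rw [← Fintype.card_congr (toLex (α := X.Field ⊕ X.Field)), Fintype.card_sum]

theorem field_cases_last {P : X.Field → Prop}
    (h0 : ∀ a : Fin (X.m (Fin.last _)), P (mkField (Fin.last _) a))
    (h1 : ∀ (s : Fin (X.L + 1)) (a : Fin (X.m s.castSucc)), P (mkField s.castSucc a))
    (α : X.Field) : P α := by
  suffices h : ∀ (k : Fin (X.L + 2)) (a : Fin (X.m k)), P (mkField k a) from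
    h (ofLex α).1 (ofLex α).2
  exact Fin.lastCases h0 h1

/-- Counting replaces injectivity: fields are exhausted by splitting off the first level and
antifields by splitting off the last one. -/
theorem rowVar_bijective :
    Function.Bijective fun p : Σ k : X.Block, Fin (rowCard k) => rowVar p.1 p.2 := by
  rw [Fintype.bijective_iff_surjective_and_card]
  constructor
  · refine var_cases (field_cases (fun i => ⟨⟨.inl (), i⟩, rfl⟩)
      fun s b => ⟨⟨.inr (.inl s), b⟩, rfl⟩)
      (field_cases_last (fun a => ⟨⟨.inr (.inr (.inr ())), a⟩, rfl⟩)
        fun s a => ⟨⟨.inr (.inr (.inl s)), a⟩, rfl⟩)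
  · rw [card_var, card_field, Fintype.card_sigma,
      Finset.sum_congr rfl fun k _ => Fintype.card_fin (rowCard k)]
    have h1 : ∑ k, X.m k = X.m 0 + ∑ s : Fin (X.L + 1), X.m s.succ := Fin.sum_univ_succ X.m
    have h2 : ∑ k, X.m k = ∑ s : Fin (X.L + 1), X.m s.castSucc + X.m (Fin.last _) :=
      Fin.sum_univ_castSucc X.m
    simp only [Fintype.sum_sum_type, rowCard, Finset.univ_unique, Finset.sum_singleton]
    omega

theorem colVar_bijective :
    Function.Bijective fun p : Σ k : X.Block, Fin (colCard k) => colVar p.1 p.2 := by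
  rw [Fintype.bijective_iff_surjective_and_card]
  constructor
  · refine var_cases (field_cases (fun i => ⟨⟨.inl (), i⟩, rfl⟩)
      fun s b => ⟨⟨.inr (.inr (.inl s)), b⟩, rfl⟩)
      (field_cases_last (fun a => ⟨⟨.inr (.inr (.inr ())), a⟩, rfl⟩)
        fun s a => ⟨⟨.inr (.inl s), a⟩, rfl⟩)
  · rw [card_var, card_field, Fintype.card_sigma,
      Finset.sum_congr rfl fun k _ => Fintype.card_fin (colCard k)]
    have h1 : ∑ k, X.m k = X.m 0 + ∑ s : Fin (X.L + 1), X.m s.succ := Fin.sum_univ_succ X.m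
    have h2 : ∑ k, X.m k = ∑ s : Fin (X.L + 1), X.m s.castSucc + X.m (Fin.last _) :=
      Fin.sum_univ_castSucc X.m
    simp only [Fintype.sum_sum_type, colCard, Finset.univ_unique, Finset.sum_singleton]
    omega

/-- The rank of a square matrix on all variables that couples only the original fields with each
other, and the stage-`s` ghosts with the antifields of the preceding stage. -/
theorem rank_of_blocks (H : Matrix X.Var X.Var ℝ)
    (h : ∀ A B, H A B ≠ 0 → (∃ i j, A = fld (mkField 0 i) ∧ B = fld (mkField 0 j)) ∨
      (∃ (s : Fin (X.L + 1)) (a : _) (b : _), A = anti (mkField s.castSucc a) ∧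
        B = fld (mkField s.succ b)) ∨
      (∃ (s : Fin (X.L + 1)) (a : _) (b : _), A = fld (mkField s.succ b) ∧
        B = anti (mkField s.castSucc a))) :
    H.rank = (H.submatrix (fun i : Fin (X.m 0) => fld (mkField 0 i))
        (fun i : Fin (X.m 0) => fld (mkField 0 i))).rank +
      ∑ s : Fin (X.L + 1), ((H.submatrix (fun b : Fin (X.m s.succ) => fld (mkField s.succ b))
          (fun a : Fin (X.m s.castSucc) => anti (mkField s.castSucc a))).rank +
        (H.submatrix (fun a : Fin (X.m s.castSucc) => anti (mkField s.castSucc a))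
          (fun b : Fin (X.m s.succ) => fld (mkField s.succ b))).rank) := by
  have hrow : ∀ {k l : X.Block} {i j}, rowVar k i = rowVar l j → k = l := fun {k l i j} hkl =>
    congrArg Sigma.fst (rowVar_bijective.1 (a₁ := ⟨k, i⟩) (a₂ := ⟨l, j⟩) hkl)
  have hcol : ∀ {k l : X.Block} {i j}, colVar k i = colVar l j → k = l := fun {k l i j} hkl =>
    congrArg Sigma.fst (colVar_bijective.1 (a₁ := ⟨k, i⟩) (a₂ := ⟨l, j⟩) hkl)
  rw [rank_block H rowVar colVar rowVar_bijective colVar_bijective, Fintype.sum_sum_type,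
    Fintype.sum_sum_type, Fintype.sum_sum_type, Finset.sum_add_distrib]
  -- The antifields of the last stage have no ghosts of a next stage to couple to, so their block is
  -- zero and only makes the labelling complete.
  · have hlast : H.submatrix (rowVar (X := X) (.inr (.inr (.inr ()))))
        (colVar (X := X) (.inr (.inr (.inr ())))) = 0 := by
      ext a b
      by_contra hab
      rcases h _ _ hab with ⟨_, _, h1, _⟩ | ⟨_, _, _, _, h1⟩ | ⟨_, _, _, h1, _⟩ <;>
        exact anti_ne_fld _ _ h1
    simp only [Finset.univ_unique, Finset.sum_singleton, PUnit.default_eq_unit, hlast,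
      Matrix.rank_zero, add_zero]
    rfl
  · intro k l i j hkl
    by_contra hne
    rcases h _ _ hne with ⟨i', j', h1, h2⟩ | ⟨s, a, b, h1, h2⟩ | ⟨s, a, b, h1, h2⟩
    · exact hkl ((hrow (l := .inl ()) (j := i') h1).trans (hcol (l := .inl ()) (j := j') h2).symm)
    · exact hkl ((hrow (l := .inr (.inr (.inl s))) (j := a) h1).trans
        (hcol (l := .inr (.inr (.inl s))) (j := b) h2).symm)
    · exact hkl ((hrow (l := .inr (.inl s)) (j := b) h1).trans
        (hcol (l := .inr (.inl s)) (j := a) h2).symm)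

end FieldContent
end BV

namespace BV.FieldContent

variable {X : FieldContent} {U : Opens X.Body}

/-! ### The Hessian -/

/-- At vanishing formal variables only the coefficient at the two differentiated variables matters,
real coordinates not being counted; the block structure is read off from this. -/
theorem coeff_ne_of_hessian {f : X.Fun U} {x : U} {A B : X.Var} (h : hessian f x A B ≠ 0) :
    f.1 (shift A + shift B) ≠ 0 := by
  have h1 : (leftDeriv A (rightDeriv B f)).1 0 ≠ 0 := fun h0 => h (by
    rw [hessian, Matrix.of_apply, value, h0]; rfl)
  have h2 := coeff_ne_of_rightDeriv (coeff_ne_of_leftDeriv h1)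
  rwa [zero_add] at h2

theorem value_add (f g : X.Fun U) (x : U) : value (f + g) x = value f x + value g x := rfl

theorem hessian_add (f g : X.Fun U) (x : U) (A B : X.Var) :
    hessian (f + g) x A B = hessian f x A B + hessian g x A B := by
  rw [hessian, Matrix.of_apply, rightDeriv_add, leftDeriv_add, value_add]; rfl

theorem hessian_sum {ι : Type*} (s : Finset ι) (f : ι → X.Fun U) (x : U) (A B : X.Var) :
    hessian (∑ i ∈ s, f i) x A B = ∑ i ∈ s, hessian (f i) x A B := by
  have h : ∀ g : ι → X.Fun U, value (∑ i ∈ s, g i) x = ∑ i ∈ s, value (g i) x := fun g => by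
    rw [value, coeff_sum]
    exact map_sum ((Pi.evalAddMonoidHom (fun _ : U => ℝ) x).comp
      (Smooth U).toSubring.subtype.toAddMonoidHom) (fun i => (g i).1 0) s
  rw [hessian, Matrix.of_apply, rightDeriv_sum, leftDeriv_sum, h]
  rfl

/-- For an even function each right derivative is a left one up to the parity of its variable, and
left derivatives commute up to the product of parities; the three signs add up. -/
theorem hessian_swap {f : X.Fun U} (hf : HasParity f 0) (x : U) (A B : X.Var) :
    hessian f x B A =
      sgn (parity A + parity B + parity A * parity B) * hessian f x A B := by
  have h : leftDeriv B (rightDeriv A f) =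
      sgn (parity A + parity B + parity A * parity B) • leftDeriv A (rightDeriv B f) := by
    rw [rightDeriv_of_even A hf, rightDeriv_of_even B hf, leftDeriv_smul, leftDeriv_smul,
      leftDeriv_comm B A]
    simp only [fun_smul_smul]
    rw [← sgn_add, ← sgn_add]
    congr 2
    linear_combination -parity B * CharTwo.two_eq_zero (R := ZMod 2)
  rw [hessian, Matrix.of_apply, h]
  rfl

theorem numGhosts_add_numAntifields_shift_le (A : X.Var) :
    numGhosts (shift A) + numAntifields (shift A) ≤ 1 := by
  refine var_cases (P := fun A => numGhosts (shift A) + numAntifields (shift A) ≤ 1) (fun α => ?_)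
    (fun α => ?_) A
  · rw [numAntifields_shift_fld]
    exact numGhosts_shift_fld_le α
  · rw [numAntifields_shift_anti, numGhosts_shift_anti]

theorem hessian_of_isOAux {f : X.Fun U} (hf : IsOAux 3 f) (x : U) (A B : X.Var) :
    hessian f x A B = 0 := by
  by_contra h
  have h1 := hf _ (coeff_ne_of_hessian h)
  rw [numGhosts_add, numAntifields_add] at h1
  have hA := numGhosts_add_numAntifields_shift_le A
  have hB := numGhosts_add_numAntifields_shift_le B
  omega

theorem eq_mkField_zero_of_shift {A : X.Var} (h1 : numGhosts (shift A) = 0)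
    (h2 : numAntifields (shift A) = 0) : ∃ i, A = fld (mkField 0 i) := by
  revert h1 h2
  refine var_cases (P := fun A => numGhosts (shift A) = 0 → numAntifields (shift A) = 0 →
    ∃ i, A = fld (mkField 0 i)) (field_cases (fun i _ _ => ⟨i, rfl⟩) fun s b h => ?_)
    (fun α _ h => ?_) A
  · rw [numGhosts_shift_ghost (α := mkField s.succ b) (Fin.succ_ne_zero s)] at h
    omega
  · rw [numAntifields_shift_anti] at h
    omega

theorem hessian_original_ne {f : X.Fun U} (hf : OriginalOnly f) {x : U} {A B : X.Var}
    (h : hessian f x A B ≠ 0) : ∃ i j, A = fld (mkField 0 i) ∧ B = fld (mkField 0 j) := by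
  have h1 := hf _ (coeff_ne_of_hessian h)
  rw [numGhosts_add, numAntifields_add] at h1
  obtain ⟨i, hi⟩ := eq_mkField_zero_of_shift (A := A) (by omega) (by omega)
  obtain ⟨j, hj⟩ := eq_mkField_zero_of_shift (A := B) (by omega) (by omega)
  exact ⟨i, j, hi, hj⟩

theorem shift_apply_of_ne {A C : X.Var} (h : C ≠ A) : shift A C = 0 := by
  classical
  by_cases hA : IsReal A
  · rw [shift_of_isReal hA]; rfl
  · rw [shift_of_not_isReal hA, Finsupp.single_eq_of_ne h]

/-- Both C and D occur in every monomial of the product, so two derivatives can leave a constant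
term only by removing exactly these two. -/
theorem hessian_coupling_ne {z : X.Fun U} {C D : X.Var} (hCD : C ≠ D) {x : U}
    {A B : X.Var} (h : hessian (gen C * z * gen D) x A B ≠ 0) :
    (A = C ∧ B = D) ∨ (A = D ∧ B = C) := by
  classical
  obtain ⟨a, b, hab, ha, hb⟩ := exists_of_coeff_mul_ne (coeff_ne_of_hessian h)
  obtain ⟨c, d, hcd, hc, hd⟩ := exists_of_coeff_mul_ne ha
  have h1 := gen_supported _ _ hb
  have h2 := gen_supported _ _ hc
  have hC : C = A ∨ C = B := by
    by_contra hne
    rw [not_or] at hne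
    have := DFunLike.congr_fun hab C
    rw [← hcd, h2, Finsupp.add_apply, Finsupp.add_apply, Finsupp.add_apply, Finsupp.single_eq_same,
      shift_apply_of_ne hne.1, shift_apply_of_ne hne.2] at this
    omega
  have hD : D = A ∨ D = B := by
    by_contra hne
    rw [not_or] at hne
    have := DFunLike.congr_fun hab D
    rw [h1, Finsupp.add_apply, Finsupp.add_apply, Finsupp.single_eq_same,
      shift_apply_of_ne hne.1, shift_apply_of_ne hne.2] at this
    omega
  rcases hC with rfl | rfl <;> rcases hD with rfl | rfl
  · exact absurd rfl hCD
  · exact Or.inl ⟨rfl, rfl⟩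
  · exact Or.inr ⟨rfl, rfl⟩
  · exact absurd rfl hCD

theorem value_mul (f g : X.Fun U) (x : U) : value (f * g) x = value f x * value g x := by
  rw [value, coeff_mul _ _ admissible_zero, Finsupp.antidiagonal_zero, Finset.sum_singleton,
    mulSign_eq, pairing_zero_left, sgn_zero, one_smul]
  rfl

theorem value_oneFun (x : U) : value (oneFun : X.Fun U) x = 1 := by
  classical
  rw [value, oneFun, coeff_ofCoeff _ admissible_zero, if_pos rfl]
  rfl

theorem originalOnly_apply_ghost {z : X.Fun U} (hz : OriginalOnly z) {α : X.Field}
    (hα : level α ≠ 0) {e : X.Var →₀ ℕ} (he : z.1 e ≠ 0) : e (fld α) = 0 := by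
  have h := (Finset.sum_eq_zero_iff.1 (hz e he).1) (fld α) (Finset.mem_univ _)
  rwa [if_pos (isGhost_fld.2 hα)] at h

theorem hessian_coupling {z : X.Fun U} (hz : OriginalOnly z) {α β : X.Field} (hβ : level β ≠ 0)
    (x : U) : hessian (gen (anti α) * z * gen (fld β)) x (anti α) (fld β) = value z x := by
  classical
  have h1 : rightDeriv (fld β) (gen (anti α) * z * gen (fld β)) = gen (anti α) * z := by
    refine rightDeriv_mul_gen (not_isReal_fld hβ) (supported_mul (gen_supported _)
      (Q := fun e => e (fld β) = 0) (fun e he => originalOnly_apply_ghost hz hβ he) ?_)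
    rintro a b rfl hb
    rw [Finsupp.add_apply, hb, Finsupp.single_eq_of_ne (anti_ne_fld α β).symm]
  have hpar : HasParity (gen (anti α) : X.Fun U) (parity (anti α)) := fun e he => by
    rw [gen_supported _ _ he, parityDegree_single]
  have h2 : leftDeriv (anti α) z = 0 := fun_ext fun e => by_contra fun he => by
    have := (hz _ (coeff_ne_of_leftDeriv he)).2
    rw [numAntifields_add, numAntifields_shift_anti] at this
    omega
  rw [hessian, Matrix.of_apply, h1, leftDeriv_mul _ hpar, h2, fun_mul_zero, fun_smul_zero, add_zero,
    leftDeriv_gen_self (not_isReal_anti α), value_mul, value_oneFun, one_mul]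

/-- The terms `Φ*_{α_{s-1}} Z^{α_{s-1}}_{α_s} c^{α_s}` of the action. -/
def couplingPart (Z : Generators X U) : X.Fun U :=
  ∑ s : Fin (X.L + 1), ∑ a : Fin (X.m s.castSucc), ∑ b : Fin (X.m s.succ),
    gen (anti (mkField s.castSucc a)) * Z s a b * gen (fld (mkField s.succ b))

theorem hessian_couplingPart_ne {Z : Generators X U} {x : U} {A B : X.Var}
    (h : hessian (couplingPart Z) x A B ≠ 0) :
    (∃ (s : Fin (X.L + 1)) (a : _) (b : _), A = anti (mkField s.castSucc a) ∧
        B = fld (mkField s.succ b)) ∨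
      (∃ (s : Fin (X.L + 1)) (a : _) (b : _), A = fld (mkField s.succ b) ∧
        B = anti (mkField s.castSucc a)) := by
  rw [couplingPart, hessian_sum] at h
  obtain ⟨s, _, h⟩ := Finset.exists_ne_zero_of_sum_ne_zero h
  rw [hessian_sum] at h
  obtain ⟨a, _, h⟩ := Finset.exists_ne_zero_of_sum_ne_zero h
  rw [hessian_sum] at h
  obtain ⟨b, _, h⟩ := Finset.exists_ne_zero_of_sum_ne_zero h
  exact (hessian_coupling_ne (anti_ne_fld _ _) h).imp (fun h => ⟨s, a, b, h⟩) fun h => ⟨s, a, b, h⟩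

theorem mkField_injective (k : Fin (X.L + 2)) : Function.Injective (mkField (X := X) k) := by
  intro a b h
  have := congrArg ofLex h
  simpa only [mkField, ofLex_toLex, Sigma.mk.injEq, heq_eq_eq, true_and] using this

theorem hessian_couplingPart {Z : Generators X U} (hZ : ∀ s a b, OriginalOnly (Z s a b)) (x : U)
    (s : Fin (X.L + 1)) (a : Fin (X.m s.castSucc)) (b : Fin (X.m s.succ)) :
    hessian (couplingPart Z) x (anti (mkField s.castSucc a)) (fld (mkField s.succ b)) =
      value (Z s a b) x := by
  have key : ∀ s' a' b', hessian (gen (anti (mkField s'.castSucc a')) * Z s' a' b' *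
      gen (fld (mkField s'.succ b'))) x (anti (mkField s.castSucc a)) (fld (mkField s.succ b)) ≠ 0 →
      anti (mkField s.castSucc a) = anti (mkField s'.castSucc a') ∧
        fld (mkField s.succ b) = fld (mkField s'.succ b') := fun s' a' b' h =>
    (hessian_coupling_ne (anti_ne_fld _ _) h).resolve_right fun h' => anti_ne_fld _ _ h'.1
  rw [couplingPart, hessian_sum, Finset.sum_eq_single_of_mem s (Finset.mem_univ s), hessian_sum,
    Finset.sum_eq_single_of_mem a (Finset.mem_univ a), hessian_sum,
    Finset.sum_eq_single_of_mem b (Finset.mem_univ b)]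
  · exact hessian_coupling (hZ s a b) (β := mkField s.succ b) (Fin.succ_ne_zero s) x
  · intro b' _ hb'
    by_contra h
    exact hb' (mkField_injective _ (fld_injective (key _ _ _ h).2)).symm
  · intro a' _ ha'
    rw [hessian_sum]
    refine Finset.sum_eq_zero fun b' _ => by_contra fun h => ?_
    exact ha' (mkField_injective _ (anti_injective (key _ _ _ h).1)).symm
  · intro s' _ hs'
    rw [hessian_sum]
    refine Finset.sum_eq_zero fun a' _ => ?_
    rw [hessian_sum]
    refine Finset.sum_eq_zero fun b' _ => by_contra fun h => hs' ?_
    exact (Fin.succ_injective _ (congrArg level (fld_injective (key _ _ _ h).2))).symm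

theorem value_ne_zero_parity {f : X.Fun U} {p : ZMod 2} (hf : HasParity f p) {x : U}
    (h : value f x ≠ 0) : p = 0 := by
  have h1 : f.1 0 ≠ 0 := fun h0 => h (by rw [value, h0]; rfl)
  rw [← hf 0 h1]
  simp [parityDegree]

/-- An even action with the correct quadratic part is proper. -/
theorem rank_hessian_eq {S₀ : X.Fun U} {Z : Generators X U} (hG : IsGaugeTheory S₀ Z) {S : X.Fun U}
    (heven : HasParity S 0) (hquad : IsOAux 3 (S - (S₀ + couplingPart Z))) (x : U)
    (hx : IsStationary S₀ x) : (hessian S x).rank = Fintype.card X.Field := by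
  classical
  have hS : ∀ A B, hessian S x A B = hessian S₀ x A B + hessian (couplingPart Z) x A B := by
    intro A B
    conv_lhs => rw [← fun_add_sub_cancel (S₀ + couplingPart Z) S]
    rw [hessian_add, hessian_of_isOAux hquad, add_zero, hessian_add]
  have h0 : ∀ A B, (¬ ∃ i j, A = fld (mkField 0 i) ∧ B = fld (mkField 0 j)) →
      hessian S₀ x A B = 0 := fun A B h =>
    by_contra fun h' => h (hessian_original_ne hG.action_original h')
  have hφ : (hessian S x).submatrix (fun i : Fin (X.m 0) => fld (mkField 0 i))
      (fun i : Fin (X.m 0) => fld (mkField 0 i)) = (hessian S₀ x).submatrix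
      (fun i : Fin (X.m 0) => fld (mkField 0 i)) (fun i : Fin (X.m 0) => fld (mkField 0 i)) := by
    ext i j
    rw [Matrix.submatrix_apply, Matrix.submatrix_apply, hS, add_eq_left]
    by_contra h
    rcases hessian_couplingPart_ne h with ⟨_, _, _, h1, _⟩ | ⟨_, _, _, _, h1⟩ <;>
      exact anti_ne_fld _ _ h1.symm
  have hZ : ∀ s a b, hessian S x (anti (mkField s.castSucc a)) (fld (mkField s.succ b)) =
      value (Z s a b) x := by
    intro s a b
    rw [hS, hessian_couplingPart hG.gen_original, h0 _ _ fun ⟨_, _, h, _⟩ => anti_ne_fld _ _ h,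
      zero_add]
  have hZm : ∀ s : Fin (X.L + 1), (hessian S x).submatrix
      (fun a : Fin (X.m s.castSucc) => anti (mkField s.castSucc a))
      (fun b : Fin (X.m s.succ) => fld (mkField s.succ b)) =
      Matrix.of fun a b => value (Z s a b) x := fun s => by
    ext a b
    exact hZ s a b
  have hZt : ∀ s : Fin (X.L + 1), (hessian S x).submatrix
      (fun b : Fin (X.m s.succ) => fld (mkField s.succ b))
      (fun a : Fin (X.m s.castSucc) => anti (mkField s.castSucc a)) =
      Matrix.diagonal (fun b : Fin (X.m s.succ) => sgn (parity (fld (mkField s.succ b)))) *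
        -- A nonzero value of Z at a point requires even parity, and then the antifield and the
        -- ghost that it couples have equal parity p. The exchange sign p + p + p² reduces to p, so
        -- it depends on the row only and does not affect the rank.
        (Matrix.of fun a b => value (Z s a b) x).transpose := fun s => by
    ext b a
    rw [Matrix.submatrix_apply, hessian_swap heven x (anti (mkField s.castSucc a)), hZ,
      Matrix.diagonal_mul, Matrix.transpose_apply, Matrix.of_apply]
    by_cases hz : value (Z s a b) x = 0
    · rw [hz, mul_zero, mul_zero]
    have hp := CharTwo.add_eq_zero.1 (value_ne_zero_parity (hG.gen_parity s a b) hz)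
    have h1 : parity (anti (mkField s.castSucc a)) = parity (fld (mkField s.succ b)) := by
      change X.ε s.castSucc a + ((s.castSucc : ℕ) : ZMod 2) + 1 =
        X.ε s.succ b + ((s.succ : ℕ) : ZMod 2)
      rw [hp, Fin.val_castSucc, Fin.val_succ, Nat.cast_add, Nat.cast_one, add_assoc]
    rw [h1]
    congr 2
    generalize parity (fld (mkField s.succ b)) = p
    revert p; decide
  have hrZ := hG.rank_gen x hx
  rw [rank_of_blocks, hφ]
  · have hrt : ∀ s : Fin (X.L + 1), ((hessian S x).submatrix
        (fun b : Fin (X.m s.succ) => fld (mkField s.succ b))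
        (fun a : Fin (X.m s.castSucc) => anti (mkField s.castSucc a))).rank =
        (Matrix.of fun a b => value (Z s a b) x).rank := fun s => by
      rw [hZt, Matrix.rank_mul_eq_right_of_isUnit_det, Matrix.rank_transpose]
      rw [Matrix.det_diagonal, isUnit_iff_ne_zero, Finset.prod_ne_zero_iff]
      exact fun b _ h => by
        have := sgn_mul_self (parity (fld (mkField s.succ b)))
        rw [h, zero_mul] at this
        exact zero_ne_one this
    have : (((hessian S₀ x).submatrix (fun i : Fin (X.m 0) => fld (mkField 0 i))
        (fun i : Fin (X.m 0) => fld (mkField 0 i))).rank : ℤ) +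
        ∑ s : Fin (X.L + 1), (((Matrix.of fun a b => value (Z s a b) x).rank : ℤ) +
          ((Matrix.of fun a b => value (Z s a b) x).rank : ℤ)) = Fintype.card X.Field := by
      rw [hG.rank_hessian x hx, card_field, Nat.cast_sum, ← sum_rankM, Finset.mul_sum]
      congr 1
      refine Finset.sum_congr rfl fun s _ => ?_
      rw [hrZ, two_mul]
    simp only [hrt, hZm]
    exact_mod_cast this
  · intro A B h
    rw [hS] at h
    by_cases h1 : hessian S₀ x A B = 0
    · rw [h1, zero_add] at h
      exact Or.inr (hessian_couplingPart_ne h)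
    · exact Or.inl (hessian_original_ne hG.action_original h1)

/-! ### The boundary conditions -/

/-- A monomial without antifields has antifield number 0; at ghost number 0 it then has no ghosts
either, and the ghost-free part of S is S₀. -/
theorem IsExtension.originalLimit {S₀ S : X.Fun U} {V : X.Field → X.Fun U} (h0 : IsKTAction S₀ V)
    (hS : IsExtension S₀ V S) : IsOAntifield 1 (S - S₀) := by
  intro e he
  by_contra hlt
  have h1 : numAntifields e = 0 := by omega
  have hgh : ghDegree e = 0 :=
    supported_sub (P := fun e => ghDegree e = 0) hS.gh
      (fun e he => ghDegree_of_original (h0.original e he)) e he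
  have h2 := numGhosts_le e
  rw [hgh, afnDegree_of_numAntifields_eq_zero h1] at h2
  have h3 : (S - (S₀ + linearPart V)).1 e = 0 := by
    by_contra h
    have := hS.form e h
    omega
  have h4 : (linearPart V).1 e = 0 := by
    by_contra h
    have := (linearPart_supported h0.degrees e h).1
    omega
  rw [coeff_sub, coeff_add, h4, add_zero] at h3
  exact he (by rw [coeff_sub, h3])

/-- The difference consists of the terms of V of order two or more in the antifields, each
multiplied by a ghost. -/
theorem linearPart_sub_couplingPart {S₀ : X.Fun U} {Z : Generators X U} {V : X.Field → X.Fun U}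
    (hV : IsKoszulTate S₀ Z V) : IsOAux 3 (linearPart V - couplingPart Z) := by
  have h1 : couplingPart Z = ∑ s : Fin (X.L + 1), ∑ b : Fin (X.m s.succ),
      (∑ a : Fin (X.m s.castSucc), gen (anti (mkField s.castSucc a)) * Z s a b) *
        gen (fld (mkField s.succ b)) := by
    rw [couplingPart]
    refine Finset.sum_congr rfl fun s _ => ?_
    rw [Finset.sum_comm]
    refine Finset.sum_congr rfl fun b _ => ?_
    rw [fun_sum_mul]
  rw [h1, linearPart, fun_sum_sub]
  simp only [fun_sum_sub, ← fun_sub_mul]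
  refine Submodule.sum_mem (supported U fun e => 3 ≤ numGhosts e + numAntifields e) fun s _ =>
    Submodule.sum_mem _ fun b _ => supported_mul (hV.linear s b) (gen_supported _) ?_
  rintro a c ha rfl
  have hg : level (mkField s.succ b) ≠ 0 := Fin.succ_ne_zero s
  rw [← shift_of_not_isReal (not_isReal_fld hg), numGhosts_add, numAntifields_add,
    numGhosts_shift_ghost hg]
  omega

/-- At ghost number 0, a term with at least two ghosts has positive antifield number and thus
contains an antifield: its order is at least three. -/
theorem IsExtension.quadratic {S₀ S : X.Fun U} {Z : Generators X U} {V : X.Field → X.Fun U}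
    (hV : IsKoszulTate S₀ Z V) (h0 : IsKTAction S₀ V) (hS : IsExtension S₀ V S) :
    IsOAux 3 (S - (S₀ + couplingPart Z)) := by
  have h1 : S - (S₀ + couplingPart Z) =
      S - (S₀ + linearPart V) + (linearPart V - couplingPart Z) :=
    fun_ext fun e => by simp only [coeff_add, coeff_sub]; abel
  rw [h1]
  refine (supported U fun e => 3 ≤ numGhosts e + numAntifields e).add_mem (fun e he => ?_)
    (linearPart_sub_couplingPart hV)
  have h2 := hS.form e he
  have hgh : ghDegree e = 0 := supported_sub (P := fun e => ghDegree e = 0) hS.gh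
    (isExtension_start h0.original h0.even h0.degrees).gh e he
  have h3 := numGhosts_le e
  by_contra hlt
  have h4 := afnDegree_of_numAntifields_eq_zero (e := e) (by omega)
  omega

end BV.FieldContent

end

/-! ### The theorem -/

theorem mainTheorem7 (X : BV.FieldContent) (U : TopologicalSpace.Opens X.Body)
    (S₀ : X.Fun U) (Z : BV.FieldContent.Generators X U) (V : X.Field → X.Fun U)
    (hS₀ : BV.FieldContent.IsGaugeTheory S₀ Z)
    (hV : BV.FieldContent.IsKoszulTate S₀ Z V)
    (hnil : BV.FieldContent.IsNilpotentKT V)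
    (hacyc : BV.FieldContent.IsAcyclicKT V) :
    ∃ S : X.Fun U, BV.FieldContent.IsProperSolution S₀ Z S ∧
      BV.FieldContent.IsOGhost 2
        (S - (S₀ + ∑ s : Fin (X.L + 1), ∑ b : Fin (X.m s.succ),
          V (BV.FieldContent.mkField s.succ b) *
            BV.FieldContent.gen (BV.FieldContent.fld (BV.FieldContent.mkField s.succ b)))) := by
  have h0 : BV.FieldContent.IsKTAction S₀ V :=
    ⟨hS₀.action_original, hS₀.action_even, hV.hasKTDegrees, hnil, hV.original⟩
  obtain ⟨S, hS, hmaster⟩ := BV.FieldContent.exists_master h0 hacyc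
  exact ⟨S, ⟨hS.even, hS.gh, hmaster, hS.originalLimit h0,
    BV.FieldContent.rank_hessian_eq hS₀ hS.even (hS.quadratic hV h0), hS.quadratic hV h0⟩, hS.form⟩
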